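/- \textbf{Setting.} Let $\Gamma'_1,\dots,\Gamma'_8$ be the standard octonionic generators of $C\ell_8$ ($(\Gamma'_i)^2=-1$) on its irreducible real module $S=\mathbb R^{16}$, $\Gamma'_9=\Gamma'_1\cdots\Gamma'_8$, and let $\Delta=S\oplus S=\mathbb R^{32}$ be the $C\ell_{1,10}$-module with (as $2\times 2$ block matrices) $$\Gamma_0=\begin{pmatrix}0&-\Gamma'_9\\ \Gamma'_9&0\end{pmatrix},\quad \Gamma_i=\begin{pmatrix}0&-\Gamma'_i\\ \Gamma'_i&0\end{pmatrix}\ (1\le i\le 8),\quad \Gamma_9=\begin{pmatrix}0&1\\1&0\end{pmatrix},\quad \Gamma_\natural=\begin{pmatrix}1&0\\0&-1\end{pmatrix}.$$ Let $e_0,\dots,e_9,e_\natural$ be the standard basis of Minkowski space $\mathbb M^{10,1}$ ($e_0$ timelike), $e_\pm=e_0\pm e_9$, $\Gamma_+=\Gamma_0+\Gamma_9$, and $\mathbb E^8=\mathrm{span}(e_1,\dots,e_8)$. Oriented planes are unit simple multivectors; they act on spinors by Clifford multiplication, and the spin groups act on them through $\mathrm{Spin}\to SO$. For a $(5,1)$-plane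 $\pi$ in $\mathbb M^{10,1}$ put $\Delta(\pi)=\{\varepsilon\in\Delta:\pi\cdot\varepsilon=\varepsilon\}$; for a $4$-plane $\zeta$ in $\mathbb E^8$ put $S(\zeta)=\{\varphi\in S:\zeta\cdot\varphi=\varphi\}$. A superscript $G$ or $K$ denotes invariants. For $0\ne\varphi\in S$ let $\Omega_\varphi(x_1,\dots,x_4)=\langle\varphi,(x_1\wedge\dots\wedge x_4)\cdot\varphi\rangle/\langle\varphi,\varphi\rangle$, a $4$-form on $\mathbb E^8$ (a Cayley form if $\varphi$ is chiral); $\zeta$ is calibrated by $\Omega_\varphi$ if $\Omega_\varphi$ has comass at most $1$ and $\Omega_\varphi(\zeta)=1$. A family of planes is \emph{$G$-related} if its members lie in one $G$-orbit and do not lie in one orbit of any proper subgroup of $G$. Let $0\neq\psi\in S$ have negative chirality ($\Gamma'_9\psi=-\psi$), let $\mathrm{Spin}_7\subset\mathrm{Spin}_8$ be its isotropy group, and let $\mathbb R^9\subset\mathrm{Spin}_{10,1}$ be the group of null rotations $1+\tfrac12\,c\,e_+$, $c\in\mathrm{span}(e_1,\dots,e_8,e_\natural)$. Let $G=K\ltimes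 N$ with $K\subset\mathrm{Spin}_7$, $N\subset\mathbb R^9$ and $N$ nontrivial. \textbf{Claim.} (1) $\Delta^N=\Delta':=\ker\Gamma_+$ is $16$-dimensional, and $j:S\to\Delta$, $j(\varphi)=\bigl(\tfrac12(1-\Gamma'_9)\varphi,\ \tfrac12(1+\Gamma'_9)\varphi\bigr)$, is a linear isomorphism of $S$ onto $\Delta'$, which is $C\ell_8$-linear when $x\in\mathbb E^8$ acts on $\Delta$ as the Clifford product $x\,e_\natural$ (so it is in particular $\mathrm{Spin}_8$-equivariant). (2) For every oriented $4$-plane $\zeta$ in $\mathbb E^8$, $\pi_\zeta:=-\tfrac12\,e_+\wedge e_-\wedge\zeta=e_0\wedge e_9\wedge\zeta$ is a $(5,1)$-plane, and $\Delta^G\cap\Delta(\pi_\zeta)=j\bigl(S^K\cap S(\zeta)\bigr)$. (3) For every oriented $4$-plane $\zeta$ in $\mathbb E^8$ and $0\ne\varphi\in S$: $\zeta\cdot\varphi=\varphi$ if and only if $\zeta$ is calibrated by $\Omega_\varphi$. (4) Let $(p_i)$ be a family of multivectors in one $G$-orbit, one of which is $p_{i_0}=\pi_\zeta$. Then all $p_i$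 are $(5,1)$-planes, $\Delta^G\cap\Delta(\pi_\zeta)\subset\bigcap_i\Delta(p_i)$, and there are $r_i\in N$ and $4$-planes $\zeta_i$ in $\mathbb E^8$ in one $K$-orbit, $\zeta_{i_0}=\zeta$, with $p_i=r_i\cdot\pi_{\zeta_i}$ for all $i$, such that every $\zeta_i$ is calibrated by $\Omega_\varphi$ for every nonzero $\varphi\in S^K\cap S(\zeta)$, and such that $(\zeta_i)$ is $K$-related if $(p_i)$ is $G$-related. If $\Delta^G\cap\Delta(\pi_\zeta)\neq0$, then $S^K\cap S(\zeta)$ contains a nonzero chiral spinor. Conversely, if $4$-planes $\zeta_i$ lie in one $K$-orbit and $r_i\in N$, then the planes $r_i\cdot\pi_{\zeta_i}$ lie in one $G$-orbit. (5) Let $(p_i)$ be a family in one $G$-orbit such that some member $p_{i_0}$ is a $(5,1)$-plane (not assumed to be of the form $\pi_\zeta$) with $(\psi,0)\in\Delta(p_{i_0})$. Then there are $r_i\in\mathbb R^9$ and $4$-planes $\zeta_i$ in $\mathbb E^8$ in one $K$-orbit, all calibrated by the Cayley form $\Omega_\psi$, with $p_i=r_i\cdot\pi_{\zeta_i}$ for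 all $i$. -/

import Mathlib

open scoped BigOperators

noncomputable section

/-! ### General notions: multivectors, the Clifford action, the spin group action -/

/-- An explicit inverse of `2` in `ℝ`, needed for the canonical isomorphism between Clifford
algebra and exterior algebra. -/
instance invertibleTwoReal : Invertible (2 : ℝ) := invertibleOfNonzero two_ne_zero

section General

variable {V : Type*} [AddCommGroup V] [Module ℝ V]

/-- The Clifford element of a multivector, through the canonical (quantisation) isomorphism
`⋀ V ≃ Cl(V, Q)`; it sends `v₁ ∧ ⋯ ∧ vₖ` to `v₁ ⋯ vₖ` when the `vᵢ` are mutually orthogonal. -/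
def toCliff (Q : QuadraticForm ℝ V) : ExteriorAlgebra ℝ V ≃ₗ[ℝ] CliffordAlgebra Q :=
  (CliffordAlgebra.equivExterior Q).symm

theorem contractLeft_prod_eq_zero (Q : QuadraticForm ℝ V) (d : Module.Dual ℝ V) :
    ∀ {m : ℕ} (v : Fin m → V), (∀ i, d (v i) = 0) →
      CliffordAlgebra.contractLeft d (List.ofFn fun i => CliffordAlgebra.ι Q (v i)).prod = 0
  | 0, v, _ => by simp
  | m + 1, v, h => by
    rw [List.ofFn_succ, List.prod_cons, CliffordAlgebra.contractLeft_ι_mul, h 0, zero_smul,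
      contractLeft_prod_eq_zero Q d (fun i => v i.succ) fun i => h i.succ, mul_zero, sub_zero]

theorem equivExterior_prod (Q : QuadraticForm ℝ V) :
    ∀ {m : ℕ} (v : Fin m → V), (∀ i j, i ≠ j → QuadraticMap.polar Q (v i) (v j) = 0) →
      CliffordAlgebra.equivExterior Q (List.ofFn fun i => CliffordAlgebra.ι Q (v i)).prod =
        ExteriorAlgebra.ιMulti ℝ m v
  | 0, v, _ => by
    rw [ExteriorAlgebra.ιMulti_zero_apply, List.ofFn_zero, List.prod_nil]
    exact CliffordAlgebra.changeForm_one CliffordAlgebra.changeForm.associated_neg_proof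
  | m + 1, v, h => by
    have ih := equivExterior_prod Q (fun i => v i.succ)
      fun i j hij => h i.succ j.succ fun e => hij (Fin.succ_injective _ e)
    have key : CliffordAlgebra.equivExterior Q (CliffordAlgebra.ι Q (v 0) *
        (List.ofFn fun i : Fin m => CliffordAlgebra.ι Q (v i.succ)).prod) = _ :=
      CliffordAlgebra.changeForm_ι_mul
        (CliffordAlgebra.changeForm.associated_neg_proof (Q := Q)) (v 0)
        (List.ofFn fun i : Fin m => CliffordAlgebra.ι Q (v i.succ)).prod
    have hdef : ∀ x, CliffordAlgebra.changeForm
        (CliffordAlgebra.changeForm.associated_neg_proof (Q := Q)) x =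
          CliffordAlgebra.equivExterior Q x := fun _ => rfl
    rw [List.ofFn_succ, List.prod_cons, key, hdef, ih, ExteriorAlgebra.ιMulti_apply,
      ExteriorAlgebra.ιMulti_apply, List.ofFn_succ, List.prod_cons]
    refine sub_eq_self.2 (contractLeft_prod_eq_zero 0 _ (fun i => v i.succ) fun i => ?_)
    have hp := h 0 i.succ (Fin.succ_ne_zero i).symm
    rw [QuadraticMap.associated_apply]
    simp only [QuadraticMap.polar, _root_.neg_apply] at hp ⊢
    rw [show -Q (v 0 + v i.succ) - -Q (v 0) - -Q (v i.succ) =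
      -(Q (v 0 + v i.succ) - Q (v 0) - Q (v i.succ)) by ring, hp, neg_zero, smul_zero]

/-- The Clifford element of a wedge product of mutually orthogonal vectors is their product. -/
theorem toCliff_ιMulti (Q : QuadraticForm ℝ V) {m : ℕ} (v : Fin m → V)
    (h : ∀ i j, i ≠ j → QuadraticMap.polar Q (v i) (v j) = 0) :
    toCliff Q (ExteriorAlgebra.ιMulti ℝ m v) =
      (List.ofFn fun i => CliffordAlgebra.ι Q (v i)).prod := by
  rw [toCliff, LinearEquiv.symm_apply_eq, equivExterior_prod Q v h]

/-- The action of `Spin(Q)` on multivectors that is induced by the covering `Spin(Q) → SO(Q)`: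
on the Clifford algebra it is conjugation, `x ↦ g x g⁻¹`. -/
def spinAct (Q : QuadraticForm ℝ V) (g : spinGroup Q) (p : ExteriorAlgebra ℝ V) :
    ExteriorAlgebra ℝ V :=
  (toCliff Q).symm ((g : CliffordAlgebra Q) * toCliff Q p * ((g⁻¹ : spinGroup Q) :
    CliffordAlgebra Q))

/-- All members of the family `p` lie in one and the same `G`-orbit. -/
def SameOrbit (Q : QuadraticForm ℝ V) {ι : Type*} (G : Subgroup (spinGroup Q))
    (p : ι → ExteriorAlgebra ℝ V) : Prop :=
  ∀ i j, ∃ g ∈ G, spinAct Q g (p i) = p j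

/-- The family `p` is `G`-related: its members lie in one `G`-orbit, and they do not lie in one
orbit of any smaller subgroup. -/
def Related (Q : QuadraticForm ℝ V) {ι : Type*} (G : Subgroup (spinGroup Q))
    (p : ι → ExteriorAlgebra ℝ V) : Prop :=
  SameOrbit Q G p ∧ ∀ G' : Subgroup (spinGroup Q), G' ≤ G → SameOrbit Q G' p → G' = G

variable {n : Type*} [Fintype n] [DecidableEq n]

/-- The subspace of spinors that are invariant under the subgroup `G` of the spin group, where the
spinors are a module over the Clifford algebra through `ρ`. -/
def invariants {Q : QuadraticForm ℝ V} (ρ : CliffordAlgebra Q →ₐ[ℝ] Matrix n n ℝ)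
    (G : Subgroup (spinGroup Q)) : Submodule ℝ (n → ℝ) where
  carrier := {ε | ∀ g ∈ G, (ρ (g : CliffordAlgebra Q)).mulVec ε = ε}
  add_mem' := by
    intro a b ha hb g hg
    rw [Matrix.mulVec_add, ha g hg, hb g hg]
  zero_mem' := by
    intro g _
    rw [Matrix.mulVec_zero]
  smul_mem' := by
    intro c a ha g hg
    rw [Matrix.mulVec_smul, ha g hg]

/-- The subspace of the spinors `ε` with `p · ε = ε`, for a multivector `p`. -/
def susy {Q : QuadraticForm ℝ V} (ρ : CliffordAlgebra Q →ₐ[ℝ] Matrix n n ℝ)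
    (p : ExteriorAlgebra ℝ V) : Submodule ℝ (n → ℝ) where
  carrier := {ε | (ρ (toCliff Q p)).mulVec ε = ε}
  add_mem' := by
    intro a b ha hb
    simp only [Set.mem_ofPred_eq] at *
    rw [Matrix.mulVec_add, ha, hb]
  zero_mem' := by
    simp only [Set.mem_ofPred_eq]
    rw [Matrix.mulVec_zero]
  smul_mem' := by
    intro c a ha
    simp only [Set.mem_ofPred_eq] at *
    rw [Matrix.mulVec_smul, ha]

/-- The isotropy subgroup of a spinor in the spin group. -/
def spinorStabilizer {Q : QuadraticForm ℝ V} (ρ : CliffordAlgebra Q →ₐ[ℝ] Matrix n n ℝ)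
    (ψ : n → ℝ) : Subgroup (spinGroup Q) where
  carrier := {g | (ρ (g : CliffordAlgebra Q)).mulVec ψ = ψ}
  one_mem' := by
    simp
  mul_mem' := by
    intro a b ha hb
    simp only [Set.mem_ofPred_eq] at *
    rw [Submonoid.coe_mul, map_mul, ← Matrix.mulVec_mulVec, hb, ha]
  inv_mem' := by
    intro a ha
    simp only [Set.mem_ofPred_eq] at *
    conv_lhs => rw [← ha]
    rw [Matrix.mulVec_mulVec, ← map_mul, ← Submonoid.coe_mul, inv_mul_cancel,
      Submonoid.coe_one, map_one, Matrix.one_mulVec]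

end General

/-- `G = K ⋉ N` as an internal semidirect product. -/
def IsSemidirect {A : Type*} [Group A] (K N G : Subgroup A) : Prop :=
  K ⊔ N = G ∧ K ⊓ N = ⊥ ∧ ∀ k ∈ K, ∀ x ∈ N, k * x * k⁻¹ ∈ N

/-- Clifford relations for a family of generators give the Clifford relation for all vectors. -/
theorem clifford_sq {m : ℕ} {A : Type*} [Ring A] [Algebra ℝ A] (γ : Fin m → A) (w : Fin m → ℝ)
    (h : ∀ i j, γ i * γ j + γ j * γ i = algebraMap ℝ A (if i = j then 2 * w i else 0))
    (v : Fin m → ℝ) :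
    Fintype.linearCombination ℝ γ v * Fintype.linearCombination ℝ γ v =
      algebraMap ℝ A (QuadraticMap.weightedSumSquares ℝ w v) := by
  have key : (2 : ℝ) • (Fintype.linearCombination ℝ γ v * Fintype.linearCombination ℝ γ v) =
      (2 : ℝ) • algebraMap ℝ A (QuadraticMap.weightedSumSquares ℝ w v) := by
    rw [two_smul]
    simp only [Fintype.linearCombination_apply, Finset.sum_mul_sum]
    nth_rewrite 2 [Finset.sum_comm]
    rw [← Finset.sum_add_distrib]
    simp only [← Finset.sum_add_distrib]
    have : ∀ i j, v i • γ i * v j • γ j + v j • γ j * v i • γ i =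
        algebraMap ℝ A (v i * v j * (if i = j then 2 * w i else 0)) := by
      intro i j
      rw [smul_mul_smul_comm, smul_mul_smul_comm, mul_comm (v j), ← smul_add, h,
        Algebra.smul_def, ← map_mul]
    simp only [this]
    rw [QuadraticMap.weightedSumSquares_apply, Algebra.smul_def, ← map_mul, Finset.mul_sum, map_sum]
    refine Finset.sum_congr rfl fun i _ => ?_
    rw [← map_sum]
    congr 1
    simp
    ring
  exact smul_right_injective A (two_ne_zero (α := ℝ)) key

/-! ### Eight dimensions: octonions, the Clifford algebra `Cl₈` and its spinor module -/

/-- Signs of the octonion multiplication table: the octonion units `o₀ = 1, o₁, …, o₇` multiply as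
`oᵢ oⱼ = octSign i j • o_{i xor j}`. -/
def octSign : Fin 8 → Fin 8 → ℤ :=
  ![![1, 1, 1, 1, 1, 1, 1, 1],
    ![1, -1, 1, -1, 1, -1, -1, 1],
    ![1, -1, -1, 1, 1, 1, -1, -1],
    ![1, 1, -1, -1, 1, -1, 1, -1],
    ![1, -1, -1, -1, -1, 1, 1, 1],
    ![1, 1, -1, 1, -1, -1, -1, 1],
    ![1, 1, 1, -1, -1, 1, -1, -1],
    ![1, -1, 1, 1, -1, -1, 1, -1]]

/-- The integer matrix of left multiplication by the imaginary octonion unit `o_{i+1}`. -/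
def octLeftInt (i : Fin 7) : Matrix (Fin 8) (Fin 8) ℤ :=
  Matrix.of fun k j => if k = i.succ ^^^ j then octSign i.succ j else 0

/-- Left multiplication by the imaginary octonion unit `o_{i+1}` on `𝕆 = ℝ⁸`. -/
def octLeft (i : Fin 7) : Matrix (Fin 8) (Fin 8) ℝ :=
  (octLeftInt i).map (Int.cast : ℤ → ℝ)

/-- The index set of the sixteen components of a `Cl₈` spinor. -/
abbrev Idx16 : Type := Fin 8 ⊕ Fin 8

/-- The generators of `Cl₈` on its irreducible real module `ℝ¹⁶`. -/
def gamma8 : Fin 8 → Matrix Idx16 Idx16 ℝ :=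
  Fin.snoc (α := fun _ => Matrix Idx16 Idx16 ℝ)
    (fun i : Fin 7 => Matrix.fromBlocks 0 (octLeft i) (octLeft i) 0)
    (Matrix.fromBlocks 0 (-1) 1 0)

/-- The product of the eight generators of `Cl₈`, the chirality operator. -/
def chir8 : Matrix Idx16 Idx16 ℝ := (List.ofFn gamma8).prod

/-- The quadratic form of `Cl₈`: minus the square of the euclidean norm of `𝔼⁸`. -/
def quad8 : QuadraticForm ℝ (Fin 8 → ℝ) := QuadraticMap.weightedSumSquares ℝ fun _ => (-1 : ℝ)

theorem octLeftInt_rel : ∀ i j : Fin 7, octLeftInt i * octLeftInt j + octLeftInt j * octLeftInt i =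
    if i = j then -2 else 0 := by
  decide +kernel

theorem octLeft_rel (i j : Fin 7) : octLeft i * octLeft j + octLeft j * octLeft i =
    algebraMap ℝ _ (if i = j then -2 else 0) := by
  have h := congrArg (fun M : Matrix (Fin 8) (Fin 8) ℤ => (Int.castRingHom ℝ).mapMatrix M)
    (octLeftInt_rel i j)
  simp only [map_add, map_mul] at h
  have h2 : ∀ i, (Int.castRingHom ℝ).mapMatrix (octLeftInt i) = octLeft i := fun i => rfl
  rw [h2, h2] at h
  rw [h]
  split_ifs
  · rw [map_neg, map_neg]
    simp only [map_ofNat]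
  · simp

theorem gamma8_castSucc (i : Fin 7) :
    gamma8 i.castSucc = Matrix.fromBlocks 0 (octLeft i) (octLeft i) 0 := by
  simp [gamma8]

theorem gamma8_last : gamma8 (Fin.last 7) = Matrix.fromBlocks 0 (-1) 1 0 := by
  exact Fin.snoc_last (α := fun _ => Matrix Idx16 Idx16 ℝ) _ _

theorem algebraMap_fromBlocks {n : Type*} [Fintype n] [DecidableEq n] (r : ℝ) :
    algebraMap ℝ (Matrix (n ⊕ n) (n ⊕ n) ℝ) r =
      Matrix.fromBlocks (algebraMap ℝ _ r) 0 0 (algebraMap ℝ _ r) := by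
  rw [Algebra.algebraMap_eq_smul_one, Algebra.algebraMap_eq_smul_one, ← Matrix.fromBlocks_one,
    Matrix.fromBlocks_smul]
  simp

theorem gamma8_rel (i j : Fin 8) : gamma8 i * gamma8 j + gamma8 j * gamma8 i =
    algebraMap ℝ _ (if i = j then 2 * (-1 : ℝ) else 0) := by
  rw [algebraMap_fromBlocks]
  induction i using Fin.lastCases with
  | last =>
    induction j using Fin.lastCases with
    | last =>
      rw [gamma8_last]
      simp [Matrix.fromBlocks_multiply, Matrix.fromBlocks_add, Algebra.algebraMap_eq_smul_one,
        ← neg_add, ← two_smul ℝ (1 : Matrix (Fin 8) (Fin 8) ℝ)]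
    | cast j =>
      rw [gamma8_last, gamma8_castSucc, if_neg (Fin.castSucc_lt_last j).ne']
      simp [Matrix.fromBlocks_multiply, Matrix.fromBlocks_add]
  | cast i =>
    induction j using Fin.lastCases with
    | last =>
      rw [gamma8_last, gamma8_castSucc, if_neg (Fin.castSucc_lt_last i).ne]
      simp [Matrix.fromBlocks_multiply, Matrix.fromBlocks_add]
    | cast j =>
      rw [gamma8_castSucc, gamma8_castSucc]
      simp only [Matrix.fromBlocks_multiply, Matrix.fromBlocks_add, octLeft_rel, zero_mul,
        mul_zero, add_zero, zero_add, Fin.castSucc_inj]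
      norm_num

/-- The spinor module of `Cl₈`. -/
def rho8 : CliffordAlgebra quad8 →ₐ[ℝ] Matrix Idx16 Idx16 ℝ :=
  CliffordAlgebra.lift quad8
    ⟨Fintype.linearCombination ℝ gamma8, clifford_sq gamma8 (fun _ => -1) gamma8_rel⟩

theorem octLeftInt_three : octLeftInt 0 * octLeftInt 1 * octLeftInt 2 =
    Matrix.diagonal ![-1, -1, -1, -1, 1, 1, 1, 1] := by
  decide +kernel

theorem octLeftInt_four : octLeftInt 3 * octLeftInt 4 * (octLeftInt 5 * octLeftInt 6) =
    Matrix.diagonal ![1, 1, 1, 1, -1, -1, -1, -1] := by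
  decide +kernel

/-- The product of the left multiplications by the seven imaginary units. -/
theorem octLeft_prod : octLeft 0 * octLeft 1 * octLeft 2 *
    (octLeft 3 * octLeft 4 * (octLeft 5 * octLeft 6)) = -1 := by
  have h : octLeftInt 0 * octLeftInt 1 * octLeftInt 2 *
      (octLeftInt 3 * octLeftInt 4 * (octLeftInt 5 * octLeftInt 6)) = -1 := by
    rw [octLeftInt_three, octLeftInt_four, Matrix.diagonal_mul_diagonal]
    decide +kernel
  have h1 := congrArg (fun M : Matrix (Fin 8) (Fin 8) ℤ => (Int.castRingHom ℝ).mapMatrix M) h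
  have h2 : ∀ i, (Int.castRingHom ℝ).mapMatrix (octLeftInt i) = octLeft i := fun i => rfl
  simpa only [map_mul, h2, map_neg, map_one] using h1

theorem chir8_eq : chir8 = Matrix.fromBlocks (-1) 0 0 1 := by
  have h := octLeft_prod
  simp only [mul_assoc] at h
  have e : chir8 = gamma8 (Fin.castSucc 0) * (gamma8 (Fin.castSucc 1) * (gamma8 (Fin.castSucc 2) *
      (gamma8 (Fin.castSucc 3) * (gamma8 (Fin.castSucc 4) * (gamma8 (Fin.castSucc 5) *
      (gamma8 (Fin.castSucc 6) * gamma8 (Fin.last 7))))))) := by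
    simp only [chir8, List.ofFn_succ, List.ofFn_zero, List.prod_cons, List.prod_nil, mul_one]
    rfl
  rw [e]
  simp only [gamma8_castSucc, gamma8_last, Matrix.fromBlocks_multiply, zero_mul, mul_zero,
    add_zero, zero_add, mul_one, mul_neg, neg_zero, h, neg_neg]

theorem chir8_sq : chir8 * chir8 = 1 := by
  rw [chir8_eq, Matrix.fromBlocks_multiply]
  simp

theorem chir8_anti (i : Fin 8) : chir8 * gamma8 i = -(gamma8 i * chir8) := by
  rw [chir8_eq]
  induction i using Fin.lastCases with
  | last =>
    rw [gamma8_last, Matrix.fromBlocks_multiply, Matrix.fromBlocks_multiply, Matrix.fromBlocks_neg]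
    simp
  | cast i =>
    rw [gamma8_castSucc, Matrix.fromBlocks_multiply, Matrix.fromBlocks_multiply,
      Matrix.fromBlocks_neg]
    simp

/-! ### Eleven dimensions: Minkowski space, `Cl₁,₁₀` and its spinor module `Δ` -/

/-- Minkowski space `𝕄¹⁰·¹`, with coordinates `0, 1, …, 9, ♮`; the index `♮` is `10`. -/
abbrev Mink : Type := Fin 11 → ℝ

/-- The diagonal entries `(-, +, …, +)` of the Minkowski metric. -/
def minkSign : Fin 11 → ℝ := Fin.cons (-1) fun _ => 1

/-- The Minkowski quadratic form. -/
def quad11 : QuadraticForm ℝ Mink := QuadraticMap.weightedSumSquares ℝ minkSign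

/-- The index set of the thirty-two components of a spinor in eleven dimensions. -/
abbrev Idx32 : Type := Idx16 ⊕ Idx16

/-- The gamma matrices `Γ₀, Γ₁, …, Γ₈, Γ₉, Γ_♮`. -/
def gamma11 : Fin 11 → Matrix Idx32 Idx32 ℝ :=
  Fin.cons (α := fun _ => Matrix Idx32 Idx32 ℝ) (Matrix.fromBlocks 0 (-chir8) chir8 0)
    (Fin.snoc (α := fun _ => Matrix Idx32 Idx32 ℝ)
      (Fin.snoc (α := fun _ => Matrix Idx32 Idx32 ℝ)
        (fun i : Fin 8 => Matrix.fromBlocks 0 (-gamma8 i) (gamma8 i) 0)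
        (Matrix.fromBlocks 0 1 1 0))
      (Matrix.fromBlocks 1 0 0 (-1)))

theorem gamma11_zero : gamma11 0 = Matrix.fromBlocks 0 (-chir8) chir8 0 := by
  simp [gamma11]

theorem gamma11_mid (i : Fin 8) :
    gamma11 i.castSucc.castSucc.succ = Matrix.fromBlocks 0 (-gamma8 i) (gamma8 i) 0 := by
  simp [gamma11]

theorem gamma11_nine : gamma11 (Fin.last 8).castSucc.succ = Matrix.fromBlocks 0 1 1 0 := by
  rw [gamma11, Fin.cons_succ, Fin.snoc_castSucc]
  exact Fin.snoc_last (α := fun _ => Matrix Idx32 Idx32 ℝ) _ _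

theorem gamma11_nat : gamma11 (Fin.last 9).succ = Matrix.fromBlocks 1 0 0 (-1) := by
  rw [gamma11, Fin.cons_succ]
  exact Fin.snoc_last (α := fun _ => Matrix Idx32 Idx32 ℝ) _ _

theorem index_cases (i : Fin 11) : i = 0 ∨ (∃ k : Fin 8, i = k.castSucc.castSucc.succ) ∨
    i = (Fin.last 8).castSucc.succ ∨ i = (Fin.last 9).succ := by
  induction i using Fin.cases with
  | zero => exact Or.inl rfl
  | succ i =>
    right
    induction i using Fin.lastCases with
    | last => exact Or.inr (Or.inr rfl)
    | cast i =>
      induction i using Fin.lastCases with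
      | last => exact Or.inr (Or.inl rfl)
      | cast i => exact Or.inl ⟨i, rfl⟩

theorem gamma11_sq (i : Fin 11) : gamma11 i * gamma11 i = algebraMap ℝ _ (minkSign i) := by
  have h8 : ∀ k, gamma8 k * gamma8 k = -1 := by
    intro k
    have h := gamma8_rel k k
    rw [if_pos rfl, ← two_smul ℝ, map_mul, ← Algebra.smul_def] at h
    have := smul_right_injective _ (two_ne_zero (α := ℝ)) h
    rw [this]
    simp
  rw [algebraMap_fromBlocks]
  rcases index_cases i with rfl | ⟨k, rfl⟩ | rfl | rfl
  · rw [gamma11_zero]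
    simp [minkSign, Matrix.fromBlocks_multiply, chir8_sq]
  · rw [gamma11_mid]
    simp [minkSign, Matrix.fromBlocks_multiply, h8]
  · rw [gamma11_nine]
    simp only [minkSign, Matrix.fromBlocks_multiply, Fin.cons_succ]
    simp
  · rw [gamma11_nat]
    simp only [minkSign, Matrix.fromBlocks_multiply, Fin.cons_succ]
    simp

theorem gamma11_anti (i j : Fin 11) (hij : i ≠ j) :
    gamma11 i * gamma11 j + gamma11 j * gamma11 i = 0 := by
  have h8 : ∀ k l, k ≠ l → gamma8 k * gamma8 l + gamma8 l * gamma8 k = 0 := by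
    intro k l hkl
    have h := gamma8_rel k l
    rwa [if_neg hkl, map_zero] at h
  rcases index_cases i with rfl | ⟨k, rfl⟩ | rfl | rfl <;>
  rcases index_cases j with rfl | ⟨l, rfl⟩ | rfl | rfl <;>
  first
  | exact absurd rfl hij
  | skip
  all_goals rw [show (0 : Matrix Idx32 Idx32 ℝ) = Matrix.fromBlocks 0 0 0 0 from
    Matrix.fromBlocks_zero.symm]
  all_goals simp only [gamma11_zero, gamma11_mid, gamma11_nine, gamma11_nat,
    Matrix.fromBlocks_multiply, Matrix.fromBlocks_add]
  all_goals simp only [zero_mul, mul_zero, zero_add, add_zero, one_mul, mul_one, neg_mul, mul_neg,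
    chir8_anti, neg_neg, neg_add_cancel, add_neg_cancel, neg_zero]
  have h := h8 k l (fun e => hij (by rw [e]))
  rw [← neg_add, h, neg_zero]

theorem gamma11_rel (i j : Fin 11) : gamma11 i * gamma11 j + gamma11 j * gamma11 i =
    algebraMap ℝ _ (if i = j then 2 * minkSign i else 0) := by
  split_ifs with h
  · subst h
    rw [gamma11_sq, ← two_smul ℝ, Algebra.smul_def, ← map_mul]
  · rw [gamma11_anti i j h, map_zero]

/-- The spinor representation `Δ` of `Cl₁,₁₀`, on `ℝ³²`. -/
def rho11 : CliffordAlgebra quad11 →ₐ[ℝ] Matrix Idx32 Idx32 ℝ :=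
  CliffordAlgebra.lift quad11
    ⟨Fintype.linearCombination ℝ gamma11, clifford_sq gamma11 minkSign gamma11_rel⟩

/-- The standard basis vector `e_M` of Minkowski space. -/
def stdVec (M : Fin 11) : Mink := Pi.single M 1

/-- The null vector `e₊ = e₀ + e₉`. -/
def ePlus : Mink := stdVec 0 + stdVec 9

/-- The null vector `e₋ = e₀ - e₉`. -/
def eMinus : Mink := stdVec 0 - stdVec 9

/-- The inclusion of `𝔼⁸` in Minkowski space, as the span of `e₁, …, e₈`. -/
def incl8 : (Fin 8 → ℝ) →ₗ[ℝ] Mink :=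
  Fintype.linearCombination ℝ fun i : Fin 8 => stdVec i.castSucc.castSucc.succ

/-- The Minkowski inner product. -/
def minkInner (x y : Mink) : ℝ := ∑ M, minkSign M * (x M * y M)

theorem quad11_apply (x : Mink) : quad11 x = minkInner x x := by
  simp [quad11, minkInner, QuadraticMap.weightedSumSquares_apply]

theorem polar_quad11 (x y : Mink) : QuadraticMap.polar quad11 x y = 2 * minkInner x y := by
  simp only [QuadraticMap.polar, quad11_apply, minkInner, Finset.mul_sum,
    ← Finset.sum_sub_distrib, Pi.add_apply]
  refine Finset.sum_congr rfl fun M _ => ?_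
  ring

theorem sum_eleven (f : Fin 11 → ℝ) :
    ∑ M, f M = f 0 + (∑ k : Fin 8, f k.castSucc.castSucc.succ) + f 9 + f 10 := by
  rw [Fin.sum_univ_succ, Fin.sum_univ_castSucc, Fin.sum_univ_castSucc]
  simp only [← add_assoc]
  rfl

theorem incl8_mid (x : Fin 8 → ℝ) (k : Fin 8) : incl8 x k.castSucc.castSucc.succ = x k := by
  simp [incl8, Fintype.linearCombination_apply, stdVec, Pi.single_apply]

theorem incl8_zero (x : Fin 8 → ℝ) : incl8 x 0 = 0 := by
  simp only [incl8, Fintype.linearCombination_apply, stdVec, Finset.sum_apply, Pi.smul_apply,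
    Pi.single_apply, smul_eq_mul]
  refine Finset.sum_eq_zero fun k _ => ?_
  rw [if_neg (Fin.succ_ne_zero _).symm, mul_zero]

theorem incl8_nine (x : Fin 8 → ℝ) : incl8 x 9 = 0 := by
  simp only [incl8, Fintype.linearCombination_apply, stdVec, Finset.sum_apply, Pi.smul_apply,
    Pi.single_apply, smul_eq_mul]
  refine Finset.sum_eq_zero fun k _ => ?_
  rw [if_neg, mul_zero]
  intro h
  have h1 := congrArg Fin.val h
  simp at h1
  omega

theorem incl8_nat (x : Fin 8 → ℝ) : incl8 x 10 = 0 := by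
  simp only [incl8, Fintype.linearCombination_apply, stdVec, Finset.sum_apply, Pi.smul_apply,
    Pi.single_apply, smul_eq_mul]
  refine Finset.sum_eq_zero fun k _ => ?_
  rw [if_neg, mul_zero]
  intro h
  have h1 := congrArg Fin.val h
  simp at h1
  omega

theorem quad11_incl8 (x : Fin 8 → ℝ) : quad11 (incl8 x) = -quad8 x := by
  have h8 : quad8 x = ∑ k, (-1 : ℝ) • (x k * x k) := QuadraticMap.weightedSumSquares_apply _ _
  rw [quad11_apply, minkInner, sum_eleven, h8, ← Finset.sum_neg_distrib]
  simp only [incl8_mid, incl8_zero, incl8_nine, incl8_nat, minkSign, Fin.cons_succ, mul_zero,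
    zero_add, add_zero]
  refine Finset.sum_congr rfl fun k _ => ?_
  simp

theorem minkInner_incl8_nat (x : Fin 8 → ℝ) : minkInner (incl8 x) (stdVec 10) = 0 := by
  rw [minkInner, Finset.sum_eq_single 10]
  · rw [incl8_nat, zero_mul, mul_zero]
  · intro b _ hb
    simp [stdVec, hb]
  · simp

theorem quad11_nat : quad11 (stdVec 10) = 1 := by
  rw [quad11_apply, minkInner, Finset.sum_eq_single 10]
  · rw [show (10 : Fin 11) = (Fin.last 9).succ from rfl]
    simp only [minkSign, Fin.cons_succ, stdVec, Pi.single_eq_same]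
    norm_num
  · intro b _ hb
    simp [stdVec, hb]
  · simp

theorem nat_sq : CliffordAlgebra.ι quad11 (stdVec 10) * CliffordAlgebra.ι quad11 (stdVec 10) = 1 := by
  rw [CliffordAlgebra.ι_sq_scalar, quad11_nat, map_one]

theorem incl8_nat_anti (x : Fin 8 → ℝ) :
    CliffordAlgebra.ι quad11 (stdVec 10) * CliffordAlgebra.ι quad11 (incl8 x) =
      -(CliffordAlgebra.ι quad11 (incl8 x) * CliffordAlgebra.ι quad11 (stdVec 10)) := by
  have h := CliffordAlgebra.ι_mul_ι_add_swap (Q := quad11) (incl8 x) (stdVec 10)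
  rw [polar_quad11, minkInner_incl8_nat, mul_zero, map_zero] at h
  exact eq_neg_of_add_eq_zero_right h

/-- The embedding `Cl₈ → Cl₁,₁₀` given on vectors of `𝔼⁸` by `x ↦ x e_♮`. On even elements it is the
natural embedding: for instance `x₁ ∧ x₂ ∧ x₃ ∧ x₄` goes to `x₁ ∧ x₂ ∧ x₃ ∧ x₄`. -/
def cliffEmb : CliffordAlgebra quad8 →ₐ[ℝ] CliffordAlgebra quad11 :=
  CliffordAlgebra.lift quad8
    ⟨LinearMap.mulRight ℝ (CliffordAlgebra.ι quad11 (stdVec 10)) ∘ₗ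
      CliffordAlgebra.ι quad11 ∘ₗ incl8, by
      intro x
      simp only [LinearMap.comp_apply, LinearMap.mulRight_apply]
      rw [mul_assoc, ← mul_assoc (CliffordAlgebra.ι quad11 (stdVec 10)), incl8_nat_anti, neg_mul,
        mul_assoc (CliffordAlgebra.ι quad11 (incl8 x)) _ (CliffordAlgebra.ι quad11 (stdVec 10)),
        nat_sq, mul_one, mul_neg, CliffordAlgebra.ι_sq_scalar, quad11_incl8, map_neg, neg_neg]⟩

theorem cliffEmb_ι (x : Fin 8 → ℝ) : cliffEmb (CliffordAlgebra.ι quad8 x) =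
    CliffordAlgebra.ι quad11 (incl8 x) * CliffordAlgebra.ι quad11 (stdVec 10) := by
  simp [cliffEmb]

theorem cliffEmb_star (x : CliffordAlgebra quad8) : cliffEmb (star x) = star (cliffEmb x) := by
  induction x using CliffordAlgebra.induction with
  | algebraMap r => simp [CliffordAlgebra.star_algebraMap]
  | ι x =>
    rw [CliffordAlgebra.star_ι, map_neg, cliffEmb_ι, star_mul, CliffordAlgebra.star_ι,
      CliffordAlgebra.star_ι, neg_mul_neg, incl8_nat_anti]
  | mul a b ha hb => rw [star_mul, map_mul, map_mul, star_mul, ha, hb]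
  | add a b ha hb => rw [star_add, map_add, map_add, star_add, ha, hb]

theorem cliffEmb_even (x : CliffordAlgebra quad8) : cliffEmb x ∈ CliffordAlgebra.even quad11 := by
  induction x using CliffordAlgebra.induction with
  | algebraMap r =>
    rw [AlgHom.commutes]
    exact Subalgebra.algebraMap_mem _ r
  | ι x =>
    rw [cliffEmb_ι]
    exact CliffordAlgebra.ι_mul_ι_mem_evenOdd_zero quad11 _ _
  | mul a b ha hb =>
    rw [map_mul]
    exact Subalgebra.mul_mem _ ha hb
  | add a b ha hb =>
    rw [map_add]
    exact Subalgebra.add_mem _ ha hb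

theorem cliffEmb_lipschitz (u : (CliffordAlgebra quad8)ˣ) (hu : u ∈ lipschitzGroup quad8) :
    Units.map (cliffEmb : CliffordAlgebra quad8 →* CliffordAlgebra quad11) u ∈
      lipschitzGroup quad11 := by
  let s : (CliffordAlgebra quad11)ˣ := ⟨_, _, nat_sq, nat_sq⟩
  have hs : s ∈ lipschitzGroup quad11 := Subgroup.subset_closure ⟨_, rfl⟩
  unfold lipschitzGroup at hu
  induction hu using Subgroup.closure_induction with
  | mem u hu =>
    obtain ⟨x, hx⟩ := hu
    have h : Units.map (cliffEmb : CliffordAlgebra quad8 →* CliffordAlgebra quad11) u * s ∈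
        lipschitzGroup quad11 := by
      refine Subgroup.subset_closure ⟨incl8 x, ?_⟩
      rw [Units.val_mul, Units.coe_map, ← hx]
      change _ = cliffEmb (CliffordAlgebra.ι quad8 x) * CliffordAlgebra.ι quad11 (stdVec 10)
      rw [cliffEmb_ι, mul_assoc, nat_sq, mul_one]
    exact (Subgroup.mul_mem_cancel_right _ hs).1 h
  | one => rw [map_one]; exact one_mem _
  | mul a b _ _ ha hb => rw [map_mul]; exact mul_mem ha hb
  | inv a _ ha => rw [map_inv]; exact inv_mem ha

theorem cliffEmb_spin (g : CliffordAlgebra quad8) (hg : g ∈ spinGroup quad8) :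
    cliffEmb g ∈ spinGroup quad11 := by
  refine ⟨⟨?_, ?_⟩, cliffEmb_even g⟩
  · obtain ⟨u, hu, rfl⟩ := hg.1.1
    exact ⟨_, cliffEmb_lipschitz u hu, rfl⟩
  · refine Unitary.mem_iff.2 ?_
    rw [← cliffEmb_star, ← map_mul, ← map_mul,
      spinGroup.star_mul_self_of_mem hg, spinGroup.mul_star_self_of_mem hg, map_one]
    exact ⟨rfl, rfl⟩

/-- The embedding `Spin₈ ⊂ Spin₁₀,₁` as the rotations of `𝔼⁸`. -/
def spinEmb : spinGroup quad8 →* spinGroup quad11 where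
  toFun g := ⟨cliffEmb g, cliffEmb_spin g g.2⟩
  map_one' := Subtype.ext (map_one cliffEmb)
  map_mul' a b := Subtype.ext (map_mul cliffEmb (a : CliffordAlgebra quad8) b)

/-- A product of two unit vectors (of positive square) lies in the spin group. -/
theorem mul_unit_mem_spin (a b : Mink) (ha : quad11 a = 1) (hb : quad11 b = 1) :
    CliffordAlgebra.ι quad11 a * CliffordAlgebra.ι quad11 b ∈ spinGroup quad11 := by
  have ha2 : CliffordAlgebra.ι quad11 a * CliffordAlgebra.ι quad11 a = 1 := by
    rw [CliffordAlgebra.ι_sq_scalar, ha, map_one]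
  have hb2 : CliffordAlgebra.ι quad11 b * CliffordAlgebra.ι quad11 b = 1 := by
    rw [CliffordAlgebra.ι_sq_scalar, hb, map_one]
  let u : (CliffordAlgebra quad11)ˣ := ⟨_, _, ha2, ha2⟩
  let v : (CliffordAlgebra quad11)ˣ := ⟨_, _, hb2, hb2⟩
  refine ⟨⟨⟨u * v, ?_, rfl⟩, ?_⟩, CliffordAlgebra.ι_mul_ι_mem_evenOdd_zero quad11 _ _⟩
  · exact mul_mem (Subgroup.subset_closure ⟨_, rfl⟩ : u ∈ lipschitzGroup quad11)
      (Subgroup.subset_closure ⟨_, rfl⟩ : v ∈ lipschitzGroup quad11)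
  · refine Unitary.mem_iff.2 ?_
    rw [star_mul, CliffordAlgebra.star_ι, CliffordAlgebra.star_ι, neg_mul_neg]
    constructor
    · rw [mul_assoc, ← mul_assoc (CliffordAlgebra.ι quad11 a), ha2, one_mul, hb2]
    · rw [mul_assoc, ← mul_assoc (CliffordAlgebra.ι quad11 b), hb2, one_mul, ha2]

theorem quad11_ePlus : quad11 ePlus = 0 := by
  rw [quad11_apply, minkInner, sum_eleven]
  have h9 : minkSign 9 = 1 := by
    rw [show (9 : Fin 11) = (Fin.last 8).castSucc.succ from rfl, minkSign, Fin.cons_succ]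
  have hk : ∀ k : Fin 8, ePlus k.castSucc.castSucc.succ = 0 := by
    intro k
    have h1 : k.castSucc.castSucc.succ ≠ (9 : Fin 11) := by
      intro h
      have h1 := congrArg Fin.val h
      simp at h1
      omega
    rw [ePlus, Pi.add_apply, stdVec, stdVec, Pi.single_eq_of_ne (Fin.succ_ne_zero _),
      Pi.single_eq_of_ne h1, add_zero]
  simp only [hk, h9]
  simp [ePlus, stdVec, minkSign]

theorem ePlus_sq : CliffordAlgebra.ι quad11 ePlus * CliffordAlgebra.ι quad11 ePlus = 0 := by
  rw [CliffordAlgebra.ι_sq_scalar, quad11_ePlus, map_zero]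

/-- A vector of Minkowski space lies in `𝔼⁹ = span {e₁, …, e₈, e_♮}`. -/
def InE9 (c : Mink) : Prop := c 0 = 0 ∧ c 9 = 0

theorem ePlus_anti (c : Mink) (hc : InE9 c) :
    CliffordAlgebra.ι quad11 ePlus * CliffordAlgebra.ι quad11 c =
      -(CliffordAlgebra.ι quad11 c * CliffordAlgebra.ι quad11 ePlus) := by
  have h := CliffordAlgebra.ι_mul_ι_add_swap (Q := quad11) c ePlus
  have h0 : minkInner c ePlus = 0 := by
    refine Finset.sum_eq_zero fun M _ => ?_
    by_cases h0 : M = 0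
    · rw [h0, hc.1, zero_mul, mul_zero]
    · by_cases h9 : M = 9
      · rw [h9, hc.2, zero_mul, mul_zero]
      · rw [ePlus, Pi.add_apply, stdVec, stdVec, Pi.single_eq_of_ne h0, Pi.single_eq_of_ne h9,
          add_zero, mul_zero, mul_zero]
  rw [polar_quad11, h0, mul_zero, map_zero] at h
  exact eq_neg_of_add_eq_zero_right h

/-- The null rotation `exp (½ c e₊) = 1 + ½ c e₊` in the Clifford algebra. -/
def nullRot (c : Mink) : CliffordAlgebra quad11 :=
  1 + (1 / 2 : ℝ) • (CliffordAlgebra.ι quad11 c * CliffordAlgebra.ι quad11 ePlus)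

theorem nullRot_mul (c d : Mink) (hd : InE9 d) :
    nullRot c * nullRot d = nullRot (c + d) := by
  have h : CliffordAlgebra.ι quad11 c * CliffordAlgebra.ι quad11 ePlus *
      (CliffordAlgebra.ι quad11 d * CliffordAlgebra.ι quad11 ePlus) = 0 := by
    rw [mul_assoc, ← mul_assoc (CliffordAlgebra.ι quad11 ePlus), ePlus_anti d hd, neg_mul,
      mul_assoc (CliffordAlgebra.ι quad11 d), ePlus_sq, mul_zero, neg_zero, mul_zero]
  simp only [nullRot, mul_add, add_mul, one_mul, mul_one, smul_mul_smul_comm, h, smul_zero,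
    map_add, smul_add, add_zero]
  rw [add_assoc]

theorem nullRot_zero : nullRot 0 = 1 := by
  simp [nullRot]

/-- Every null rotation is an element of `Spin₁₀,₁`. -/
theorem nullRot_mem (c : Mink) (hc : InE9 c) : nullRot c ∈ spinGroup quad11 := by
  by_cases h0 : c = 0
  · rw [h0, nullRot_zero]
    exact one_mem _
  have hq : quad11 c = ∑ M, c M * c M := by
    rw [quad11_apply]
    refine Finset.sum_congr rfl fun M _ => ?_
    induction M using Fin.cases with
    | zero => rw [hc.1, zero_mul, mul_zero]
    | succ M => rw [minkSign, Fin.cons_succ, one_mul]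
  have hpos : 0 < quad11 c := by
    rw [hq]
    obtain ⟨M, hM⟩ := Function.ne_iff.1 h0
    exact Finset.sum_pos' (fun i _ => mul_self_nonneg _)
      ⟨M, Finset.mem_univ _, mul_self_pos.2 hM⟩
  set r : ℝ := Real.sqrt (quad11 c) with hr
  have hr0 : r ≠ 0 := (Real.sqrt_pos.2 hpos).ne'
  have hrr : r * r = quad11 c := Real.mul_self_sqrt hpos.le
  have ha : quad11 (r⁻¹ • c) = 1 := by
    rw [QuadraticMap.map_smul, ← hrr, smul_eq_mul]
    field_simp
  have hp : QuadraticMap.polar quad11 (r⁻¹ • c) ((r / 2) • ePlus) = 0 := by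
    have h := CliffordAlgebra.ι_mul_ι_add_swap (Q := quad11) c ePlus
    rw [ePlus_anti c hc, add_neg_cancel] at h
    have h2 : QuadraticMap.polar quad11 c ePlus = 0 :=
      (algebraMap ℝ (CliffordAlgebra quad11)).injective (by rw [← h, map_zero])
    rw [QuadraticMap.polar_smul_left, QuadraticMap.polar_smul_right, h2, smul_zero, smul_zero]
  have hb : quad11 (r⁻¹ • c + (r / 2) • ePlus) = 1 := by
    rw [QuadraticMap.map_add quad11, ha, hp, QuadraticMap.map_smul, quad11_ePlus, smul_zero, add_zero,
      add_zero]
  have hm := mul_unit_mem_spin _ _ ha hb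
  rw [map_add, mul_add, CliffordAlgebra.ι_sq_scalar, ha, map_one, map_smul, map_smul,
    smul_mul_smul_comm] at hm
  have e : r⁻¹ * (r / 2) = 1 / 2 := by
    field_simp
  rwa [e] at hm

/-- The group `ℝ⁹ ⊂ Spin₁₀,₁` of null rotations fixing `e₊`. -/
def nullRotations : Subgroup (spinGroup quad11) where
  carrier := {g | ∃ c : Mink, InE9 c ∧ (g : CliffordAlgebra quad11) = nullRot c}
  one_mem' := ⟨0, ⟨rfl, rfl⟩, by rw [nullRot_zero]; rfl⟩
  mul_mem' := by
    rintro a b ⟨c, hc, ha⟩ ⟨d, hd, hb⟩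
    refine ⟨c + d, ⟨?_, ?_⟩, ?_⟩
    · rw [Pi.add_apply, hc.1, hd.1, add_zero]
    · rw [Pi.add_apply, hc.2, hd.2, add_zero]
    · rw [Submonoid.coe_mul, ha, hb, nullRot_mul c d hd]
  inv_mem' := by
    rintro a ⟨c, hc, ha⟩
    have hc' : InE9 (-c) := by
      refine ⟨?_, ?_⟩
      · rw [Pi.neg_apply, hc.1, neg_zero]
      · rw [Pi.neg_apply, hc.2, neg_zero]
    refine ⟨-c, hc', ?_⟩
    have h1 : (a : CliffordAlgebra quad11) * nullRot (-c) = 1 := by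
      rw [ha, nullRot_mul c (-c) hc', add_neg_cancel, nullRot_zero]
    have h2 : ((a⁻¹ : spinGroup quad11) : CliffordAlgebra quad11) * a = 1 := by
      rw [← Submonoid.coe_mul, inv_mul_cancel, Submonoid.coe_one]
    calc ((a⁻¹ : spinGroup quad11) : CliffordAlgebra quad11)
        = (a⁻¹ : spinGroup quad11) * ((a : CliffordAlgebra quad11) * nullRot (-c)) := by
          rw [h1, mul_one]
      _ = nullRot (-c) := by rw [← mul_assoc, h2, one_mul]

/-! ### Planes, Cayley forms, and the reduction -/

/-- An orthonormal quadruple of vectors in `𝔼⁸`. -/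
def IsFrame8 (w : Fin 4 → Fin 8 → ℝ) : Prop :=
  ∀ a b, ∑ i, w a i * w b i = if a = b then 1 else 0

/-- An oriented `4`-plane in `𝔼⁸`, as the unit simple `4`-vector `w₁ ∧ w₂ ∧ w₃ ∧ w₄`. -/
def IsPlane8 (ζ : ExteriorAlgebra ℝ (Fin 8 → ℝ)) : Prop :=
  ∃ w, IsFrame8 w ∧ ζ = ExteriorAlgebra.ιMulti ℝ 4 w

/-- An oriented `(5,1)`-plane in Minkowski space, as the unit simple `6`-vector
`v₀ ∧ v₁ ∧ ⋯ ∧ v₅` of an orthonormal basis with `v₀` timelike. (It is time-oriented by the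
time orientation of Minkowski space.) -/
def IsPlane51 (p : ExteriorAlgebra ℝ Mink) : Prop :=
  ∃ v : Fin 6 → Mink,
    (∀ a b, minkInner (v a) (v b) = if a = b then (if a = 0 then -1 else 1) else 0) ∧
      p = ExteriorAlgebra.ιMulti ℝ 6 v

/-- The `6`-vector `-½ e₊ ∧ e₋ ∧ ζ`, normalised so as to have unit norm if `ζ` has. -/
def brane (ζ : ExteriorAlgebra ℝ (Fin 8 → ℝ)) : ExteriorAlgebra ℝ Mink :=
  (-1 / 2 : ℝ) • (ExteriorAlgebra.ι ℝ ePlus * ExteriorAlgebra.ι ℝ eMinus *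
    ExteriorAlgebra.map incl8 ζ)

theorem brane_eq (ζ : ExteriorAlgebra ℝ (Fin 8 → ℝ)) :
    brane ζ = ExteriorAlgebra.ι ℝ (stdVec 0) * ExteriorAlgebra.ι ℝ (stdVec 9) *
      ExteriorAlgebra.map incl8 ζ := by
  have h := ExteriorAlgebra.ι_add_mul_swap (R := ℝ) (stdVec 0) (stdVec 9)
  have h' : ExteriorAlgebra.ι ℝ (stdVec 9) * ExteriorAlgebra.ι ℝ (stdVec 0) =
      -(ExteriorAlgebra.ι ℝ (stdVec 0) * ExteriorAlgebra.ι ℝ (stdVec 9)) :=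
    eq_neg_of_add_eq_zero_right h
  rw [brane, ePlus, eMinus, map_add, map_sub, add_mul, mul_sub, mul_sub,
    ExteriorAlgebra.ι_sq_zero, ExteriorAlgebra.ι_sq_zero, h', zero_sub, sub_zero, ← two_smul ℝ,
    ← smul_mul_assoc, smul_smul, smul_neg, ← neg_smul]
  norm_num

/-- The subspace `Δ'` of the spinors that are annihilated by `Γ₊`. -/
def deltaPrime : Submodule ℝ (Idx32 → ℝ) :=
  LinearMap.ker (Matrix.mulVecLin (rho11 (CliffordAlgebra.ι quad11 ePlus)))

/-- The map `φ = ψ₋ + χ₊ ↦ (ψ₋, χ₊)` from `Cl₈` spinors, decomposed into chiral components, to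
spinors in eleven dimensions. -/
def spinorIncl : (Idx16 → ℝ) →ₗ[ℝ] (Idx32 → ℝ) :=
  Matrix.mulVecLin (Matrix.fromRows ((1 / 2 : ℝ) • (1 - chir8)) ((1 / 2 : ℝ) • (1 + chir8)))

/-- The normalised `4`-form `Ω_φ (x₁, …, x₄) = ⟨φ, (x₁ ∧ x₂ ∧ x₃ ∧ x₄) · φ⟩ / ⟨φ, φ⟩` on `𝔼⁸` that
is built by squaring the spinor `φ`. For chiral `φ ≠ 0` it is a Cayley form. -/
def cayleyForm (φ : Idx16 → ℝ) : (Fin 8 → ℝ) [⋀^Fin 4]→ₗ[ℝ] ℝ :=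
  ({ toFun := fun p => (φ ⬝ᵥ φ)⁻¹ * (φ ⬝ᵥ (rho8 (toCliff quad8 p)).mulVec φ)
     map_add' := by
      intro p q
      rw [map_add, map_add, Matrix.add_mulVec, dotProduct_add, mul_add]
     map_smul' := by
      intro r p
      rw [map_smul, map_smul, Matrix.smul_mulVec, dotProduct_smul, RingHom.id_apply,
        smul_eq_mul, smul_eq_mul, mul_left_comm] } :
    ExteriorAlgebra ℝ (Fin 8 → ℝ) →ₗ[ℝ] ℝ).compAlternatingMap (ExteriorAlgebra.ιMulti ℝ 4)

/-- The `4`-form `Ω` has comass at most one, and `ζ` is an oriented `4`-plane on which `Ω` takes the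
value one; in other words, `ζ` is calibrated by `Ω`. -/
def IsCalibrated (Ω : (Fin 8 → ℝ) [⋀^Fin 4]→ₗ[ℝ] ℝ) (ζ : ExteriorAlgebra ℝ (Fin 8 → ℝ)) : Prop :=
  (∀ x, IsFrame8 x → Ω x ≤ 1) ∧
    ∃ w, IsFrame8 w ∧ ζ = ExteriorAlgebra.ιMulti ℝ 4 w ∧ Ω w = 1

end

/-!
A null rotation `1 + ½ c e₊` fixes `ε` exactly when `c e₊ ε = 0`, and a nonzero `c ∈ ℝ⁹` is
spacelike, hence acts invertibly; so one nontrivial null rotation already cuts out `ker Γ₊`. On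
`ker Γ₊` the product `e₀ e₉` is the identity, so `e₀ ∧ e₉ ∧ ζ` acts there as `ζ` does on `S`. A
`4`-plane `ζ` acts on `S` by an orthogonal transformation, hence `⟨φ, ζ φ⟩ ≤ ⟨φ, φ⟩` with equality
exactly for `ζ φ = φ`: this is the calibration inequality. Orbits are reduced by `G = N K`, where
`K` fixes `e₀` and `e₉`.

A general `(5,1)`-plane `π` that fixes the null spinor `ε = (ψ, 0)` is brought into this form as
follows. Vectors in `π` anticommute with `π` and vectors orthogonal to `π` commute with it, so if
a vector has `ε` as an eigenvector, then its component in `π` kills `ε` and is null. For `e₊` the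
orthogonal component kills `ε` as well; being null and orthogonal to a timelike vector it
vanishes, so `e₊ ∈ π`. A frame of `π` with `u₀ + u₁ = e₊` is then a null rotation of a frame
through `e₀` and `e₉`. In that position `e_♮` is orthogonal to `e₀` and fixes `ε`, so its
component in `π` is null and orthogonal to `e₀`, hence zero, and the rest of the frame lies
in `𝔼⁸`.
-/

noncomputable section

open scoped Matrix
open CliffordAlgebra (ι involute)
open ExteriorAlgebra (ιMulti)
open QuadraticMap (associated)

open CliffordAlgebra (ι)

section AlternatingMaps

variable {R M W m : Type*} [CommRing R] [AddCommGroup M] [Module R M] [AddCommGroup W] [Module R W]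

theorem alternatingMap_ext_apply_basis [Finite m] (b : Module.Basis m R M) {f g : M [⋀^m]→ₗ[R] W}
    (h : f b = g b) : f = g := by
  classical
  have := Fintype.ofFinite m
  refine b.ext_alternating fun s hs => ?_
  have hσ : (fun i => b (s i)) =
      b ∘ Equiv.ofBijective s (Finite.injective_iff_bijective.1 hs) := rfl
  rw [hσ, f.map_perm, g.map_perm, h]

variable [Fintype m] [DecidableEq m]

theorem alternatingMap_sum_smul (f : M [⋀^m]→ₗ[R] W) (v : m → M) (A : Matrix m m R) :
    f (fun i => ∑ j, A i j • v j) = A.det • f v := by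
  have h : f.compLinearMap (Fintype.linearCombination R v) =
      (LinearMap.toSpanSingleton R W (f v)).compAlternatingMap (Pi.basisFun R m).det := by
    refine alternatingMap_ext_apply_basis (Pi.basisFun R m) ?_
    rw [LinearMap.compAlternatingMap_apply, Module.Basis.det_self]
    simp [Fintype.linearCombination_apply_single]
  rw [Pi.basisFun_det] at h
  exact congrArg (fun g => g A) h

end AlternatingMaps

section SpinAction

variable {V : Type*} [AddCommGroup V] [Module ℝ V] (Q : QuadraticForm ℝ V) (g h : spinGroup Q)

theorem equivExterior_ι (v : V) :
    CliffordAlgebra.equivExterior Q (ι Q v) = ExteriorAlgebra.ι ℝ v :=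
  CliffordAlgebra.changeForm_ι CliffordAlgebra.changeForm.associated_neg_proof v

theorem cliffordAlgebra_ι_injective : Function.Injective (ι Q) := fun x y h =>
  (ExteriorAlgebra.ι_inj ℝ x y).1 <| by rw [← equivExterior_ι Q, h, equivExterior_ι]

/-- Conjugation by an element `g` of the spin group, `x ↦ g x g⁻¹`, as an algebra automorphism of
the Clifford algebra; `spinAct` is its transport to multivectors. -/
def spinConj : spinGroup Q →* (CliffordAlgebra Q ≃ₐ[ℝ] CliffordAlgebra Q) :=
  (MulSemiringAction.toAlgAut (ConjAct (CliffordAlgebra Q)ˣ) ℝ (CliffordAlgebra Q)).comp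
    (ConjAct.toConjAct.toMonoidHom.comp spinGroup.toUnits)

theorem spinConj_apply (x : CliffordAlgebra Q) :
    spinConj Q g x = g * x * (g⁻¹ : spinGroup Q) :=
  rfl

theorem spinConj_eq_iff {x y : CliffordAlgebra Q} :
    spinConj Q g x = y ↔ g * x = y * (g : CliffordAlgebra Q) :=
  (spinGroup.toUnits g).mul_inv_eq_iff_eq_mul

theorem toCliff_spinAct (p : ExteriorAlgebra ℝ V) :
    toCliff Q (spinAct Q g p) = spinConj Q g (toCliff Q p) :=
  (toCliff Q).apply_symm_apply _

theorem spinAct_one (p : ExteriorAlgebra ℝ V) : spinAct Q 1 p = p :=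
  (toCliff Q).injective <| by rw [toCliff_spinAct, map_one, AlgEquiv.one_apply]

theorem spinAct_mul (p : ExteriorAlgebra ℝ V) :
    spinAct Q (g * h) p = spinAct Q g (spinAct Q h p) :=
  (toCliff Q).injective <| by simp only [toCliff_spinAct, map_mul, AlgEquiv.mul_apply]

theorem spinAct_inv_eq_iff (p q : ExteriorAlgebra ℝ V) :
    spinAct Q g⁻¹ p = q ↔ p = spinAct Q g q := by
  constructor
  · rintro rfl
    rw [← spinAct_mul, mul_inv_cancel, spinAct_one]
  · rintro rfl
    rw [← spinAct_mul, inv_mul_cancel, spinAct_one]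

/-- The vector representation of the spin group, `v ↦ g v g⁻¹`. It is read off from the action on
multivectors through the projection `ExteriorAlgebra.ιInv` onto vectors. -/
def vecAct : V →ₗ[ℝ] V :=
  ExteriorAlgebra.ιInv ∘ₗ CliffordAlgebra.equivExterior Q ∘ₗ (spinConj Q g).toLinearMap ∘ₗ ι Q

theorem ι_vecAct (v : V) : ι Q (vecAct Q g v) = spinConj Q g (ι Q v) := by
  obtain ⟨w, hw⟩ : spinConj Q g (ι Q v) ∈ LinearMap.range (ι Q) :=
    spinGroup.conjAct_smul_ι_mem_range_ι (x := spinGroup.toUnits g) g.2 v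
  have hvw : vecAct Q g v = w := by
    change ExteriorAlgebra.ιInv (CliffordAlgebra.equivExterior Q (spinConj Q g (ι Q v))) = w
    rw [← hw, equivExterior_ι, ExteriorAlgebra.ι_leftInverse]
  rw [hvw, hw]

theorem vecAct_eq_iff {v w : V} :
    vecAct Q g v = w ↔ g * ι Q v = ι Q w * (g : CliffordAlgebra Q) := by
  rw [← (cliffordAlgebra_ι_injective Q).eq_iff, ι_vecAct, spinConj_eq_iff]

theorem vecAct_vecAct_inv (v : V) : vecAct Q g (vecAct Q g⁻¹ v) = v := by
  apply cliffordAlgebra_ι_injective Q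
  rw [ι_vecAct, ι_vecAct, ← AlgEquiv.mul_apply, ← map_mul, mul_inv_cancel, map_one,
    AlgEquiv.one_apply]

theorem polar_vecAct (v w : V) :
    QuadraticMap.polar Q (vecAct Q g v) (vecAct Q g w) = QuadraticMap.polar Q v w := by
  apply (algebraMap ℝ (CliffordAlgebra Q)).injective
  simp only [← CliffordAlgebra.ι_mul_ι_add_swap, ι_vecAct, ← map_mul, ← map_add]
  rw [CliffordAlgebra.ι_mul_ι_add_swap, AlgEquiv.commutes]

variable {Q} in
theorem isOrtho_iff_polar_eq_zero {v w : V} :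
    Q.IsOrtho v w ↔ QuadraticMap.polar Q v w = 0 :=
  QuadraticMap.isOrtho_polarBilin.symm

variable {Q} in
theorem isOrtho_vecAct {v w : V} (hvw : Q.IsOrtho v w) :
    Q.IsOrtho (vecAct Q g v) (vecAct Q g w) := by
  rwa [isOrtho_iff_polar_eq_zero, polar_vecAct, ← isOrtho_iff_polar_eq_zero]

variable {Q} in
theorem toCliff_ιMulti_of_isOrtho {m : ℕ} {v : Fin m → V}
    (hv : Pairwise fun i j => Q.IsOrtho (v i) (v j)) :
    toCliff Q (ιMulti ℝ m v) = ((List.ofFn v).map (ι Q)).prod := by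
  rw [toCliff_ιMulti Q v fun _ _ hij => (hv hij).polar_eq_zero, List.map_ofFn]
  rfl

variable {Q} in
theorem spinAct_ιMulti {m : ℕ} {v : Fin m → V}
    (hv : Pairwise fun i j => Q.IsOrtho (v i) (v j)) :
    spinAct Q g (ιMulti ℝ m v) = ιMulti ℝ m fun i => vecAct Q g (v i) := by
  apply (toCliff Q).injective
  rw [toCliff_spinAct, toCliff_ιMulti_of_isOrtho hv,
    toCliff_ιMulti_of_isOrtho fun _ _ hij => isOrtho_vecAct g (hv hij), map_list_prod,
    List.map_ofFn, List.map_ofFn, List.map_ofFn]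
  simp only [Function.comp_def, ι_vecAct]

variable {n : Type*} [Fintype n] [DecidableEq n] {Q} (ρ : CliffordAlgebra Q →ₐ[ℝ] Matrix n n ℝ)

theorem mem_susy_spinAct {g : spinGroup Q} {ε : n → ℝ} (hg : g ∈ spinorStabilizer ρ ε)
    (p : ExteriorAlgebra ℝ V) : ε ∈ susy ρ (spinAct Q g p) ↔ ε ∈ susy ρ p := by
  suffices h : ∀ {g} (_ : g ∈ spinorStabilizer ρ ε) {p}, ε ∈ susy ρ p → ε ∈ susy ρ (spinAct Q g p)
    from ⟨fun hp => (spinAct_inv_eq_iff Q g _ p).2 rfl ▸ h (inv_mem hg) hp, h hg⟩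
  intro g (hg : ρ g *ᵥ ε = ε) p (hp : ρ (toCliff Q p) *ᵥ ε = ε)
  have hg' : ρ (g⁻¹ : spinGroup Q) *ᵥ ε = ε := inv_mem (show g ∈ spinorStabilizer ρ ε from hg)
  change ρ (toCliff Q (spinAct Q g p)) *ᵥ ε = ε
  rw [toCliff_spinAct, spinConj_apply, map_mul, map_mul, ← Matrix.mulVec_mulVec, hg',
    ← Matrix.mulVec_mulVec, hp, hg]

end SpinAction

section OrthogonalMatrix

variable {R n : Type*} [CommRing R] [Fintype n] [DecidableEq n] {X : Matrix n n R}

theorem dotProduct_sub_mulVec_self (hX : Xᵀ * X = 1) (φ : n → R) :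
    (φ - X *ᵥ φ) ⬝ᵥ (φ - X *ᵥ φ) = 2 * (φ ⬝ᵥ φ - φ ⬝ᵥ X *ᵥ φ) := by
  have hiso : X *ᵥ φ ⬝ᵥ X *ᵥ φ = φ ⬝ᵥ φ := by
    rw [Matrix.dotProduct_mulVec, ← Matrix.mulVec_transpose, Matrix.mulVec_mulVec, hX,
      Matrix.one_mulVec]
  rw [sub_dotProduct, dotProduct_sub, dotProduct_sub, hiso, dotProduct_comm (X *ᵥ φ) φ]
  ring

variable [LinearOrder R] [IsStrictOrderedRing R]

theorem dotProduct_mulVec_le_dotProduct_self (hX : Xᵀ * X = 1) (φ : n → R) :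
    φ ⬝ᵥ X *ᵥ φ ≤ φ ⬝ᵥ φ := by
  have h : 0 ≤ (φ - X *ᵥ φ) ⬝ᵥ (φ - X *ᵥ φ) := Finset.sum_nonneg fun _ _ => mul_self_nonneg _
  rw [dotProduct_sub_mulVec_self hX] at h
  linarith

theorem dotProduct_mulVec_eq_dotProduct_self_iff (hX : Xᵀ * X = 1) {φ : n → R} :
    φ ⬝ᵥ X *ᵥ φ = φ ⬝ᵥ φ ↔ X *ᵥ φ = φ := by
  refine ⟨fun h => ?_, fun h => by rw [h]⟩
  rw [eq_comm, ← sub_eq_zero, ← dotProduct_self_eq_zero, dotProduct_sub_mulVec_self hX, h,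
    sub_self, mul_zero]

end OrthogonalMatrix

theorem dotProduct_self_pos {n : Type*} [Fintype n] {φ : n → ℝ} (hφ : φ ≠ 0) : 0 < φ ⬝ᵥ φ := by
  simpa only [star_trivial] using Matrix.dotProduct_star_self_pos_iff.2 hφ

theorem exists_mem_mulVec_eq_self_or_neg {R n : Type*} [CommRing R] [Fintype n] [DecidableEq n]
    {A : Matrix n n R} (hA : A * A = 1) {S : Submodule R (n → R)} (hS : ∀ φ ∈ S, A *ᵥ φ ∈ S)
    (hne : S ≠ ⊥) : ∃ φ ∈ S, φ ≠ 0 ∧ (A *ᵥ φ = φ ∨ A *ᵥ φ = -φ) := by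
  obtain ⟨φ, hφ, hφ0⟩ := S.exists_mem_ne_zero_of_ne_bot hne
  by_cases h : A *ᵥ φ + φ = 0
  · exact ⟨φ, hφ, hφ0, Or.inr (eq_neg_of_add_eq_zero_left h)⟩
  · refine ⟨A *ᵥ φ + φ, add_mem (hS φ hφ) hφ, h, Or.inl ?_⟩
    rw [Matrix.mulVec_add, Matrix.mulVec_mulVec, hA, Matrix.one_mulVec, add_comm]

section CliffordProducts

variable {R M : Type*} [CommRing R] [AddCommGroup M] [Module R M] {Q : QuadraticForm R M}

theorem star_prod_map_ι_mul_self (l : List M) :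
    star (l.map (ι Q)).prod * (l.map (ι Q)).prod = algebraMap R _ (l.map fun v => -Q v).prod := by
  induction l with
  | nil => simp
  | cons v l ih =>
    simp only [List.map_cons, List.prod_cons]
    calc star (ι Q v * (l.map (ι Q)).prod) * (ι Q v * (l.map (ι Q)).prod)
        = star (l.map (ι Q)).prod * (-(ι Q v * ι Q v) * (l.map (ι Q)).prod) := by
          simp only [star_mul, CliffordAlgebra.star_ι, mul_assoc, neg_mul, mul_neg]
      _ = algebraMap R _ (-Q v) * (star (l.map (ι Q)).prod * (l.map (ι Q)).prod) := by
          rw [CliffordAlgebra.ι_sq_scalar, ← map_neg, Algebra.left_comm]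
      _ = algebraMap R _ (-Q v * (l.map fun v => -Q v).prod) := by rw [ih, map_mul]

end CliffordProducts

/-! ### The spinor module of `Cl₈` -/

theorem rho8_ι (x : Fin 8 → ℝ) : rho8 (ι quad8 x) = Fintype.linearCombination ℝ gamma8 x :=
  CliffordAlgebra.lift_ι_apply _ _ x

theorem octLeft_transpose (i : Fin 7) : (octLeft i)ᵀ = -octLeft i := by
  have h : (octLeftInt i)ᵀ = -octLeftInt i := by decide +kernel +revert
  rw [octLeft, ← Matrix.transpose_map, h]
  exact map_neg (Int.castRingHom ℝ).mapMatrix _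

theorem gamma8_transpose (i : Fin 8) : (gamma8 i)ᵀ = -gamma8 i := by
  induction i using Fin.lastCases with
  | last =>
    rw [gamma8_last]
    simp [Matrix.fromBlocks_transpose, Matrix.fromBlocks_neg]
  | cast i =>
    simp [gamma8_castSucc, Matrix.fromBlocks_transpose, Matrix.fromBlocks_neg, octLeft_transpose]

theorem rho8_star (x : CliffordAlgebra quad8) : rho8 (star x) = (rho8 x)ᵀ := by
  induction x using CliffordAlgebra.induction with
  | algebraMap r =>
    rw [CliffordAlgebra.star_algebraMap, AlgHom.commutes, Matrix.algebraMap_eq_diagonal,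
      Matrix.diagonal_transpose]
  | ι x =>
    rw [CliffordAlgebra.star_ι, map_neg, rho8_ι, Fintype.linearCombination_apply,
      Matrix.transpose_sum, ← Finset.sum_neg_distrib]
    simp only [Matrix.transpose_smul, gamma8_transpose, smul_neg]
  | mul a b ha hb => rw [star_mul, map_mul, map_mul, Matrix.transpose_mul, ha, hb]
  | add a b ha hb => rw [star_add, map_add, map_add, Matrix.transpose_add, ha, hb]

theorem chir8_mul_rho8 (x : CliffordAlgebra quad8) :
    chir8 * rho8 x = rho8 (involute x) * chir8 := by
  induction x using CliffordAlgebra.induction with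
  | algebraMap r => rw [AlgHom.commutes, AlgHom.commutes, AlgHom.commutes, ← Algebra.commutes]
  | ι x =>
    rw [CliffordAlgebra.involute_ι, map_neg, rho8_ι, Fintype.linearCombination_apply,
      Finset.mul_sum, neg_mul, Finset.sum_mul, ← Finset.sum_neg_distrib]
    simp only [mul_smul_comm, smul_mul_assoc, chir8_anti, smul_neg]
  | mul a b ha hb => rw [map_mul, map_mul, map_mul, ← mul_assoc, ha, mul_assoc, hb, mul_assoc]
  | add a b ha hb => rw [map_add, map_add, map_add, mul_add, add_mul, ha, hb]

theorem rho8_mulVec_chir8_mulVec {x : CliffordAlgebra quad8}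
    (hx : involute x = x) {φ : Idx16 → ℝ} (hφ : rho8 x *ᵥ φ = φ) :
    rho8 x *ᵥ (chir8 *ᵥ φ) = chir8 *ᵥ φ := by
  nth_rw 1 [← hx]
  rw [Matrix.mulVec_mulVec, ← chir8_mul_rho8, ← Matrix.mulVec_mulVec, hφ]

theorem quad8_apply (x : Fin 8 → ℝ) : quad8 x = -∑ i, x i * x i := by
  simp [quad8, QuadraticMap.weightedSumSquares_apply]

theorem polar_quad8 (x y : Fin 8 → ℝ) :
    QuadraticMap.polar quad8 x y = -2 * ∑ i, x i * y i := by
  simp only [QuadraticMap.polar, quad8_apply, Finset.mul_sum, ← Finset.sum_neg_distrib,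
    ← Finset.sum_sub_distrib, Pi.add_apply]
  exact Finset.sum_congr rfl fun i _ => by ring

section CayleyForms

variable {w : Fin 4 → Fin 8 → ℝ} {ζ : ExteriorAlgebra ℝ (Fin 8 → ℝ)} {φ : Idx16 → ℝ}

theorem IsFrame8.isOrtho (hw : IsFrame8 w) : Pairwise fun i j => quad8.IsOrtho (w i) (w j) :=
  fun i j hij => isOrtho_iff_polar_eq_zero.2 <| by rw [polar_quad8, hw, if_neg hij, mul_zero]

theorem IsFrame8.quad8_eq (hw : IsFrame8 w) (i : Fin 4) : quad8 (w i) = -1 := by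
  rw [quad8_apply, hw, if_pos rfl]

theorem IsFrame8.vecAct (hw : IsFrame8 w) (g : spinGroup quad8) :
    IsFrame8 fun i => vecAct quad8 g (w i) := by
  intro i j
  have h := polar_vecAct quad8 g (w i) (w j)
  rw [polar_quad8, polar_quad8, hw] at h
  linarith

theorem IsFrame8.transpose_rho8_mul_self (hw : IsFrame8 w) :
    (rho8 (toCliff quad8 (ιMulti ℝ 4 w)))ᵀ * rho8 (toCliff quad8 (ιMulti ℝ 4 w)) = 1 := by
  rw [← rho8_star, ← map_mul, toCliff_ιMulti_of_isOrtho hw.isOrtho, star_prod_map_ι_mul_self]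
  simp [List.ofFn_succ, hw.quad8_eq]

theorem cayleyForm_apply (φ : Idx16 → ℝ) (w : Fin 4 → Fin 8 → ℝ) :
    cayleyForm φ w = (φ ⬝ᵥ φ)⁻¹ * (φ ⬝ᵥ rho8 (toCliff quad8 (ιMulti ℝ 4 w)) *ᵥ φ) :=
  rfl

theorem IsFrame8.cayleyForm_le_one (hw : IsFrame8 w) (hφ : φ ≠ 0) : cayleyForm φ w ≤ 1 := by
  rw [cayleyForm_apply, inv_mul_le_iff₀ (dotProduct_self_pos hφ), mul_one]
  exact dotProduct_mulVec_le_dotProduct_self hw.transpose_rho8_mul_self φ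

theorem IsFrame8.cayleyForm_eq_one_iff (hw : IsFrame8 w) (hφ : φ ≠ 0) :
    cayleyForm φ w = 1 ↔ φ ∈ susy rho8 (ιMulti ℝ 4 w) := by
  rw [cayleyForm_apply, inv_mul_eq_one₀ (dotProduct_self_pos hφ).ne', eq_comm]
  exact dotProduct_mulVec_eq_dotProduct_self_iff hw.transpose_rho8_mul_self

theorem IsPlane8.mem_susy_iff_isCalibrated (hζ : IsPlane8 ζ) (hφ : φ ≠ 0) :
    φ ∈ susy rho8 ζ ↔ IsCalibrated (cayleyForm φ) ζ := by
  constructor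
  · obtain ⟨w, hw, rfl⟩ := hζ
    exact fun h => ⟨fun x hx => hx.cayleyForm_le_one hφ, w, hw, rfl,
      (hw.cayleyForm_eq_one_iff hφ).2 h⟩
  · rintro ⟨-, w, hw, rfl, h⟩
    exact (hw.cayleyForm_eq_one_iff hφ).1 h

theorem IsPlane8.spinAct (hζ : IsPlane8 ζ) (g : spinGroup quad8) :
    IsPlane8 (spinAct quad8 g ζ) := by
  obtain ⟨w, hw, rfl⟩ := hζ
  exact ⟨_, hw.vecAct g, spinAct_ιMulti g hw.isOrtho⟩

theorem IsPlane8.involute_toCliff (hζ : IsPlane8 ζ) :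
    involute (toCliff quad8 ζ) = toCliff quad8 ζ := by
  obtain ⟨w, hw, rfl⟩ := hζ
  rw [toCliff_ιMulti_of_isOrtho hw.isOrtho, CliffordAlgebra.involute_prod_map_ι, List.length_ofFn,
    Even.neg_one_pow (by decide), one_smul]

theorem IsPlane8.exists_chiral_mem (hζ : IsPlane8 ζ) {K : Subgroup (spinGroup quad8)}
    (h : invariants rho8 K ⊓ susy rho8 ζ ≠ ⊥) :
    ∃ φ ∈ invariants rho8 K ⊓ susy rho8 ζ, φ ≠ 0 ∧ (chir8 *ᵥ φ = φ ∨ chir8 *ᵥ φ = -φ) :=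
  exists_mem_mulVec_eq_self_or_neg chir8_sq (fun _ hφ =>
    ⟨fun g hg => rho8_mulVec_chir8_mulVec (spinGroup.involute_eq g.2) (hφ.1 g hg),
      rho8_mulVec_chir8_mulVec hζ.involute_toCliff hφ.2⟩) h

end CayleyForms

/-! ### The spinor module of `Cl₁,₁₀` -/

theorem rho11_ι (x : Mink) : rho11 (ι quad11 x) = Fintype.linearCombination ℝ gamma11 x :=
  CliffordAlgebra.lift_ι_apply _ _ x

theorem rho11_stdVec (M : Fin 11) : rho11 (ι quad11 (stdVec M)) = gamma11 M := by
  rw [rho11_ι, stdVec, Fintype.linearCombination_apply_single, one_smul]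

theorem rho11_ePlus : rho11 (ι quad11 ePlus) = Matrix.fromBlocks 0 (1 - chir8) (1 + chir8) 0 := by
  have h9 : gamma11 9 = Matrix.fromBlocks 0 1 1 0 := gamma11_nine
  rw [ePlus, map_add, map_add, rho11_stdVec, rho11_stdVec, gamma11_zero, h9,
    Matrix.fromBlocks_add, add_zero, neg_add_eq_sub, add_comm chir8]

theorem rho11_incl8 (x : Fin 8 → ℝ) :
    rho11 (ι quad11 (incl8 x)) =
      Matrix.fromBlocks 0 (-rho8 (ι quad8 x)) (rho8 (ι quad8 x)) 0 := by
  rw [incl8, Fintype.linearCombination_apply, map_sum, map_sum, rho8_ι,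
    Fintype.linearCombination_apply]
  simp only [map_smul, rho11_stdVec, gamma11_mid]
  ext (i | i) (j | j) <;> simp [Matrix.sum_apply]

theorem rho11_cliffEmb_ι (x : Fin 8 → ℝ) :
    rho11 (cliffEmb (ι quad8 x)) =
      Matrix.fromBlocks 0 (rho8 (ι quad8 x)) (rho8 (ι quad8 x)) 0 := by
  have hnat : gamma11 10 = Matrix.fromBlocks 1 0 0 (-1) := gamma11_nat
  rw [cliffEmb_ι, map_mul, rho11_incl8, rho11_stdVec, hnat, Matrix.fromBlocks_multiply]
  simp

theorem spinorIncl_apply (φ : Idx16 → ℝ) :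
    spinorIncl φ = Sum.elim ((1 / 2 : ℝ) • (φ - chir8 *ᵥ φ)) ((1 / 2 : ℝ) • (φ + chir8 *ᵥ φ)) := by
  rw [spinorIncl, Matrix.mulVecLin_apply, Matrix.fromRows_mulVec, Matrix.smul_mulVec,
    Matrix.smul_mulVec, Matrix.sub_mulVec, Matrix.add_mulVec, Matrix.one_mulVec]

theorem chir8_mulVec_mulVec (φ : Idx16 → ℝ) : chir8 *ᵥ (chir8 *ᵥ φ) = φ := by
  rw [Matrix.mulVec_mulVec, chir8_sq, Matrix.one_mulVec]

theorem spinorIncl_injective : Function.Injective spinorIncl := by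
  refine Function.LeftInverse.injective (g := fun ε => ε ∘ Sum.inl + ε ∘ Sum.inr) fun φ => ?_
  simp only [spinorIncl_apply, Sum.elim_comp_inl, Sum.elim_comp_inr]
  module

theorem mem_deltaPrime_iff {ε : Idx32 → ℝ} :
    ε ∈ deltaPrime ↔ chir8 *ᵥ (ε ∘ Sum.inl) = -(ε ∘ Sum.inl) ∧
      chir8 *ᵥ (ε ∘ Sum.inr) = ε ∘ Sum.inr := by
  rw [deltaPrime, LinearMap.mem_ker, Matrix.mulVecLin_apply, rho11_ePlus, Matrix.fromBlocks_mulVec,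
    Matrix.zero_mulVec, Matrix.zero_mulVec, zero_add, add_zero, Matrix.sub_mulVec,
    Matrix.add_mulVec, Matrix.one_mulVec, Matrix.one_mulVec, ← Sum.elim_zero_zero,
    Sum.elim_eq_iff, sub_eq_zero, add_eq_zero_iff_eq_neg', and_comm, eq_comm (a := ε ∘ Sum.inr)]

theorem range_spinorIncl : LinearMap.range spinorIncl = deltaPrime := by
  ext ε
  rw [mem_deltaPrime_iff]
  constructor
  · rintro ⟨φ, rfl⟩
    rw [spinorIncl_apply, Sum.elim_comp_inl, Sum.elim_comp_inr, Matrix.mulVec_smul,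
      Matrix.mulVec_smul, Matrix.mulVec_sub, Matrix.mulVec_add, chir8_mulVec_mulVec]
    exact ⟨by module, by module⟩
  · rintro ⟨hinl, hinr⟩
    refine ⟨ε ∘ Sum.inl + ε ∘ Sum.inr, ?_⟩
    rw [spinorIncl_apply, Matrix.mulVec_add, hinl, hinr, ← Sum.elim_comp_inl_inr ε]
    congr 1 <;> · simp only [Sum.elim_comp_inl, Sum.elim_comp_inr]; module

theorem finrank_deltaPrime : Module.finrank ℝ deltaPrime = 16 := by
  rw [← range_spinorIncl, LinearMap.finrank_range_of_inj spinorIncl_injective]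
  simp

theorem spinorIncl_mulVec (x : CliffordAlgebra quad8) (φ : Idx16 → ℝ) :
    spinorIncl (rho8 x *ᵥ φ) = rho11 (cliffEmb x) *ᵥ spinorIncl φ := by
  induction x using CliffordAlgebra.induction generalizing φ with
  | algebraMap r =>
    simp only [AlgHom.commutes]
    simp only [Algebra.algebraMap_eq_smul_one, Matrix.smul_mulVec, Matrix.one_mulVec, map_smul]
  | ι x =>
    have hchir : chir8 *ᵥ (rho8 (ι quad8 x) *ᵥ φ) = -(rho8 (ι quad8 x) *ᵥ (chir8 *ᵥ φ)) := by
      rw [Matrix.mulVec_mulVec, chir8_mul_rho8, CliffordAlgebra.involute_ι, map_neg, neg_mul,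
        Matrix.neg_mulVec, Matrix.mulVec_mulVec]
    rw [rho11_cliffEmb_ι, spinorIncl_apply, spinorIncl_apply, hchir, Matrix.fromBlocks_mulVec]
    simp only [Sum.elim_comp_inl, Sum.elim_comp_inr, Matrix.zero_mulVec, add_zero, zero_add,
      Matrix.mulVec_smul, Matrix.mulVec_add, Matrix.mulVec_sub, sub_neg_eq_add, sub_self,
      smul_zero]
    rw [← sub_eq_add_neg]
  | mul a b ha hb =>
    rw [map_mul, map_mul, map_mul, ← Matrix.mulVec_mulVec, ← Matrix.mulVec_mulVec, ha, hb]
  | add a b ha hb =>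
    rw [map_add, map_add, map_add, Matrix.add_mulVec, Matrix.add_mulVec, map_add, ha, hb]

theorem ePlus_mulVec_spinorIncl (φ : Idx16 → ℝ) : rho11 (ι quad11 ePlus) *ᵥ spinorIncl φ = 0 := by
  have h : spinorIncl φ ∈ deltaPrime := range_spinorIncl ▸ ⟨φ, rfl⟩
  exact h

section Representations

variable {V n : Type*} [AddCommGroup V] [Module ℝ V] {Q : QuadraticForm ℝ V} [Fintype n]
  [DecidableEq n] (ρ : CliffordAlgebra Q →ₐ[ℝ] Matrix n n ℝ)

theorem ι_mulVec_ι_mulVec (v : V) (ε : n → ℝ) : ρ (ι Q v) *ᵥ (ρ (ι Q v) *ᵥ ε) = Q v • ε := by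
  rw [Matrix.mulVec_mulVec, ← map_mul, CliffordAlgebra.ι_sq_scalar, AlgHom.commutes,
    Algebra.algebraMap_eq_smul_one, Matrix.smul_mulVec, Matrix.one_mulVec]

theorem eq_zero_of_ι_mulVec_eq_zero {v : V} {ε : n → ℝ} (hε : ε ≠ 0) (h : ρ (ι Q v) *ᵥ ε = 0) :
    Q v = 0 := by
  have hsq := ι_mulVec_ι_mulVec ρ v ε
  rw [h, Matrix.mulVec_zero, eq_comm, smul_eq_zero] at hsq
  exact hsq.resolve_right hε

end Representations

theorem nullRot_mulVec (c : Mink) (ε : Idx32 → ℝ) :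
    rho11 (nullRot c) *ᵥ ε =
      ε + (1 / 2 : ℝ) • (rho11 (ι quad11 c) *ᵥ (rho11 (ι quad11 ePlus) *ᵥ ε)) := by
  rw [nullRot, map_add, map_one, map_smul, map_mul, Matrix.add_mulVec, Matrix.one_mulVec,
    Matrix.smul_mulVec, Matrix.mulVec_mulVec]

theorem nullRotations_le_spinorStabilizer {ε : Idx32 → ℝ} (hε : ε ∈ deltaPrime) :
    nullRotations ≤ spinorStabilizer rho11 ε := by
  rintro r ⟨c, -, hr⟩
  have hε' : rho11 (ι quad11 ePlus) *ᵥ ε = 0 := hε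
  change rho11 r *ᵥ ε = ε
  rw [hr, nullRot_mulVec, hε', Matrix.mulVec_zero, smul_zero, add_zero]

theorem InE9.quad11_eq {c : Mink} (hc : InE9 c) : quad11 c = c ⬝ᵥ c := by
  rw [quad11_apply, minkInner, dotProduct, Fin.sum_univ_succ,
    Fin.sum_univ_succ fun M => c M * c M]
  simp [minkSign, hc.1]

theorem InE9.quad11_eq_zero_iff {c : Mink} (hc : InE9 c) : quad11 c = 0 ↔ c = 0 := by
  rw [hc.quad11_eq, dotProduct_self_eq_zero]

theorem invariants_eq_deltaPrime {N : Subgroup (spinGroup quad11)} (hN : N ≤ nullRotations)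
    (hN1 : N ≠ ⊥) : invariants rho11 N = deltaPrime := by
  refine le_antisymm (fun ε hε => ?_) fun ε hε => hN.trans (nullRotations_le_spinorStabilizer hε)
  obtain ⟨g, hg, hg1⟩ := (Subgroup.bot_or_exists_ne_one N).resolve_left hN1
  obtain ⟨c, hc, hgc⟩ := hN hg
  have hcε : rho11 (ι quad11 c) *ᵥ (rho11 (ι quad11 ePlus) *ᵥ ε) = 0 := by
    have h := hε g hg
    rw [hgc, nullRot_mulVec, add_eq_left] at h
    exact (smul_eq_zero.1 h).resolve_left (by norm_num)
  by_contra hne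
  have hc0 : c = 0 := hc.quad11_eq_zero_iff.1 (eq_zero_of_ι_mulVec_eq_zero rho11 hne hcε)
  exact hg1 (Subtype.ext (by rw [hgc, hc0, nullRot_zero, Submonoid.coe_one]))

section SemidirectProducts

variable {A : Type*} [Group A] {K K' N G : Subgroup A}

open scoped Pointwise in
theorem exists_mul_eq_of_mem_sup (h : ∀ k ∈ K, ∀ x ∈ N, k * x * k⁻¹ ∈ N) {g : A}
    (hg : g ∈ K ⊔ N) : ∃ x ∈ N, ∃ k ∈ K, x * k = g := by
  have hNK : ((N ⊔ K : Subgroup A) : Set A) = (N : Set A) * (K : Set A) :=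
    Subgroup.coe_mul_of_right_le_normalizer_left N K (Subgroup.le_normalizer_iff.2 h)
  rw [sup_comm, ← SetLike.mem_coe, hNK] at hg
  exact Set.mem_mul.1 hg

theorem IsSemidirect.eq_of_le_of_sup_eq (h : IsSemidirect K N G) (hK' : K' ≤ K)
    (hG : K' ⊔ N = G) : K' = K := by
  refine le_antisymm hK' fun k hk => ?_
  have hkG : k ∈ K' ⊔ N := hG ▸ h.1 ▸ Subgroup.mem_sup_left hk
  obtain ⟨x, hx, k', hk', rfl⟩ := exists_mul_eq_of_mem_sup (fun k hk => h.2.2 k (hK' hk)) hkG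
  have hxK : x ∈ K ⊓ N := ⟨(mul_mem_cancel_right (hK' hk')).1 hk, hx⟩
  rw [h.2.1, Subgroup.mem_bot] at hxK
  rwa [hxK, one_mul]

end SemidirectProducts

section Orbits

variable {V κ n : Type*} [AddCommGroup V] [Module ℝ V] {Q : QuadraticForm ℝ V}
  {G G' K N : Subgroup (spinGroup Q)} {p : κ → ExteriorAlgebra ℝ V}

theorem sameOrbit_iff_exists (i₀ : κ) :
    SameOrbit Q G p ↔ ∀ i, ∃ g ∈ G, spinAct Q g (p i₀) = p i := by
  refine ⟨fun h => h i₀, fun h i j => ?_⟩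
  obtain ⟨g, hg, hgi⟩ := h i
  obtain ⟨k, hk, hkj⟩ := h j
  refine ⟨k * g⁻¹, mul_mem hk (inv_mem hg), ?_⟩
  rw [spinAct_mul, (spinAct_inv_eq_iff Q g _ _).2 hgi.symm, hkj]

theorem SameOrbit.mono (h : SameOrbit Q G p) (hG : G ≤ G') : SameOrbit Q G' p := fun i j =>
  (h i j).imp fun _ hg => ⟨hG hg.1, hg.2⟩

variable [Fintype n] [DecidableEq n] (ρ : CliffordAlgebra Q →ₐ[ℝ] Matrix n n ℝ)

theorem SameOrbit.inf_susy_le (h : SameOrbit Q G p) (i₀ : κ) :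
    invariants ρ G ⊓ susy ρ (p i₀) ≤ ⨅ i, susy ρ (p i) := by
  refine le_iInf fun i ε hε => ?_
  obtain ⟨g, hg, hgi⟩ := h i₀ i
  rw [← hgi]
  exact (mem_susy_spinAct ρ (hε.1 g hg) _).2 hε.2

theorem mem_invariants_iff_le_spinorStabilizer {ε : n → ℝ} :
    ε ∈ invariants ρ G ↔ G ≤ spinorStabilizer ρ ε :=
  Iff.rfl

theorem invariants_sup : invariants ρ (K ⊔ N) = invariants ρ K ⊓ invariants ρ N := by
  ext ε
  simp only [Submodule.mem_inf, mem_invariants_iff_le_spinorStabilizer, sup_le_iff]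

end Orbits

/-! ### Gram matrices -/

section GramMatrices

variable {R M W m : Type*} [CommRing R] [AddCommGroup M] [Module R M] [AddCommGroup W]
  [Module R W] [Fintype m]

theorem gram_sum_smul (B : M →ₗ[R] M →ₗ[R] R) (v : m → M) (A : Matrix m m R) :
    (Matrix.of fun i j => B (∑ k, A i k • v k) (∑ k, A j k • v k)) =
      A * (Matrix.of fun i j => B (v i) (v j)) * Aᵀ := by
  ext i j
  simp only [Matrix.mul_apply, Matrix.transpose_apply, Matrix.of_apply, map_sum, map_smul,
    LinearMap.sum_apply, LinearMap.smul_apply, smul_eq_mul, mul_comm]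

theorem alternatingMap_eq_or_eq_neg_of_gram_eq [DecidableEq m] [IsDomain R] (B : M →ₗ[R] M →ₗ[R] R)
    {u v : m → M} (huv : ∀ i, u i ∈ Submodule.span R (Set.range v))
    (h : ∀ i j, B (u i) (u j) = B (v i) (v j))
    (hdet : (Matrix.of fun i j => B (v i) (v j)).det ≠ 0) (f : M [⋀^m]→ₗ[R] W) :
    f u = f v ∨ f u = -f v := by
  obtain ⟨A, hA⟩ : ∃ A : Matrix m m R, ∀ i, ∑ j, A i j • v j = u i :=
    Classical.axiomOfChoice fun i => (Submodule.mem_span_range_iff_exists_fun R).1 (huv i)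
  have hgram := congrArg Matrix.det (gram_sum_smul B v A)
  simp only [hA, h] at hgram
  rw [Matrix.det_mul, Matrix.det_mul, Matrix.det_transpose, mul_right_comm, eq_comm] at hgram
  rw [← funext hA, alternatingMap_sum_smul]
  rcases mul_self_eq_one_iff.1 ((mul_eq_right₀ hdet).1 hgram) with hdetA | hdetA
  · exact Or.inl (by rw [hdetA, one_smul])
  · exact Or.inr (by rw [hdetA, neg_one_smul])

end GramMatrices

/-! ### Clifford products of orthogonal vectors -/

section CliffordProducts

variable {R M : Type*} [CommRing R] [AddCommGroup M] [Module R M] {Q : QuadraticForm R M}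
  {c : M} {l : List M}

theorem ι_mul_prod_map_ι_of_isOrtho (h : ∀ v ∈ l, Q.IsOrtho c v) :
    ι Q c * (l.map (ι Q)).prod = (-1 : R) ^ l.length • ((l.map (ι Q)).prod * ι Q c) := by
  induction l with
  | nil => simp
  | cons v l ih =>
    rw [List.forall_mem_cons] at h
    rw [List.map_cons, List.prod_cons, CliffordAlgebra.ι_mul_ι_mul_of_isOrtho _ h.1, ih h.2,
      mul_smul_comm, List.length_cons, pow_succ, mul_neg_one, neg_smul, mul_assoc]

theorem commute_ι_prod_map_ι (h : ∀ v ∈ l, Q.IsOrtho c v) (hl : Even l.length) :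
    Commute (ι Q c) (l.map (ι Q)).prod := by
  rw [Commute, SemiconjBy, ι_mul_prod_map_ι_of_isOrtho h, hl.neg_one_pow, one_smul]

theorem ι_mul_prod_map_ι_of_mem (hl : l.Pairwise Q.IsOrtho) (hc : c ∈ l) :
    ι Q c * (l.map (ι Q)).prod = (-1 : R) ^ (l.length + 1) • ((l.map (ι Q)).prod * ι Q c) := by
  induction l with
  | nil => simp at hc
  | cons v l ih =>
    rw [List.pairwise_cons] at hl
    rw [List.map_cons, List.prod_cons, List.length_cons, mul_assoc]
    obtain rfl | hc := List.mem_cons.1 hc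
    · rw [ι_mul_prod_map_ι_of_isOrtho hl.1, mul_smul_comm, pow_succ, pow_succ, mul_assoc,
        neg_one_mul, neg_neg, mul_one]
    · rw [CliffordAlgebra.ι_mul_ι_mul_of_isOrtho _ (hl.1 c hc).symm, ih hl.2 hc, mul_smul_comm,
        pow_succ _ (l.length + 1), mul_neg_one, neg_smul]

end CliffordProducts

/-! ### Spinors preserved by a multivector -/

section OrthogonalMultivectors

variable {V : Type*} [AddCommGroup V] [Module ℝ V] {Q : QuadraticForm ℝ V} {m : ℕ}
  {v : Fin m → V}

theorem commute_ι_toCliff_ιMulti (hv : Pairwise fun i j => Q.IsOrtho (v i) (v j)) (hm : Even m)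
    {b : V} (hb : ∀ i, Q.IsOrtho b (v i)) : Commute (ι Q b) (toCliff Q (ιMulti ℝ m v)) := by
  rw [toCliff_ιMulti_of_isOrtho hv]
  exact commute_ι_prod_map_ι ((List.forall_mem_ofFn_iff).2 hb) (by rwa [List.length_ofFn])

theorem ι_mul_toCliff_ιMulti (hv : Pairwise fun i j => Q.IsOrtho (v i) (v j)) (hm : Even m)
    {a : V} (ha : a ∈ Submodule.span ℝ (Set.range v)) :
    ι Q a * toCliff Q (ιMulti ℝ m v) = -(toCliff Q (ιMulti ℝ m v) * ι Q a) := by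
  rw [toCliff_ιMulti_of_isOrtho hv]
  have hl : (List.ofFn v).Pairwise Q.IsOrtho :=
    List.pairwise_ofFn.2 fun _ _ hij => hv hij.ne
  induction ha using Submodule.span_induction with
  | mem x hx =>
    rw [ι_mul_prod_map_ι_of_mem hl ((List.mem_ofFn' _ _).2 hx), List.length_ofFn,
      hm.add_one.neg_one_pow, neg_one_smul]
  | zero => simp only [map_zero, zero_mul, mul_zero, neg_zero]
  | add x y _ _ hx hy => rw [map_add, add_mul, mul_add, hx, hy, neg_add]
  | smul r x _ hx => rw [map_smul, smul_mul_assoc, mul_smul_comm, hx, smul_neg]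

theorem exists_mem_span_isOrtho_sub (hv : Pairwise fun i j => Q.IsOrtho (v i) (v j))
    (hQ : ∀ i, Q (v i) ≠ 0) (c : V) :
    ∃ a ∈ Submodule.span ℝ (Set.range v), ∀ i, Q.IsOrtho (c - a) (v i) := by
  refine ⟨∑ j, (associated Q c (v j) / Q (v j)) • v j,
    Submodule.sum_smul_mem _ _ fun j _ => Submodule.mem_span_of_mem ⟨j, rfl⟩, fun i => ?_⟩
  rw [← QuadraticMap.associated_isOrtho, map_sub, map_sum, LinearMap.sub_apply,
    LinearMap.sum_apply, Finset.sum_eq_single i]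
  · rw [map_smul, LinearMap.smul_apply, QuadraticMap.associated_eq_self_apply, smul_eq_mul,
      div_mul_cancel₀ _ (hQ i), sub_self]
  · intro j _ hji
    rw [map_smul, LinearMap.smul_apply, QuadraticMap.associated_isOrtho.2 (hv hji), smul_zero]
  · simp

variable {n : Type*} [Fintype n] [DecidableEq n] {ρ : CliffordAlgebra Q →ₐ[ℝ] Matrix n n ℝ}
  {ε : n → ℝ}

theorem ι_mulVec_eq_zero_of_add (hv : Pairwise fun i j => Q.IsOrtho (v i) (v j)) (hm : Even m)
    (hε : ε ∈ susy ρ (ιMulti ℝ m v)) {a b : V} (ha : a ∈ Submodule.span ℝ (Set.range v))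
    (hb : ∀ i, Q.IsOrtho b (v i)) {s : ℝ} (h : ρ (ι Q (a + b)) *ᵥ ε = s • ε) :
    ρ (ι Q a) *ᵥ ε = 0 := by
  set P := toCliff Q (ιMulti ℝ m v)
  have hP : ρ P *ᵥ ε = ε := hε
  have hPa : ρ P *ᵥ (ρ (ι Q a) *ᵥ ε) = -(ρ (ι Q a) *ᵥ ε) := by
    rw [Matrix.mulVec_mulVec, ← map_mul, ← neg_eq_iff_eq_neg.2 (ι_mul_toCliff_ιMulti hv hm ha),
      map_neg, Matrix.neg_mulVec, map_mul, ← Matrix.mulVec_mulVec, hP]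
  have hPb : ρ P *ᵥ (ρ (ι Q b) *ᵥ ε) = ρ (ι Q b) *ᵥ ε := by
    rw [Matrix.mulVec_mulVec, ← map_mul, ← (commute_ι_toCliff_ιMulti hv hm hb).eq, map_mul,
      ← Matrix.mulVec_mulVec, hP]
  rw [map_add, map_add, Matrix.add_mulVec] at h
  have hs : -(ρ (ι Q a) *ᵥ ε) + ρ (ι Q b) *ᵥ ε = ρ (ι Q a) *ᵥ ε + ρ (ι Q b) *ᵥ ε := by
    rw [← hPa, ← hPb, ← Matrix.mulVec_add, hPb, h, Matrix.mulVec_smul, hP]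
  exact self_eq_neg.1 (add_right_cancel hs).symm

end OrthogonalMultivectors

/-! ### Lorentz frames -/

section LorentzFrames

variable {V : Type*} [AddCommGroup V] [Module ℝ V] {Q : QuadraticForm ℝ V} {n : ℕ}

theorem associated_vecAct (g : spinGroup Q) (v w : V) :
    associated Q (vecAct Q g v) (vecAct Q g w) = associated Q v w := by
  have h := polar_vecAct Q g v w
  simp only [QuadraticMap.polar] at h
  rw [QuadraticMap.associated_apply, QuadraticMap.associated_apply, h]

/-- An orthonormal system of signature `(n, 1)`, with the timelike vector first. -/
def IsLorentzFrame (Q : QuadraticForm ℝ V) (v : Fin (n + 1) → V) : Prop :=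
  ∀ a b, associated Q (v a) (v b) = if a = b then (if a = 0 then -1 else 1) else 0

theorem isLorentzFrame_cons {x₀ x₁ : V} {x : Fin n → V} (h00 : associated Q x₀ x₀ = -1)
    (h11 : associated Q x₁ x₁ = 1) (h01 : associated Q x₀ x₁ = 0)
    (h0 : ∀ a, associated Q x₀ (x a) = 0) (h1 : ∀ a, associated Q x₁ (x a) = 0)
    (hx : ∀ a b, associated Q (x a) (x b) = if a = b then 1 else 0) :
    IsLorentzFrame Q (Fin.cons x₀ (Fin.cons x₁ x) : Fin (n + 2) → V) := by
  have h10 : associated Q x₁ x₀ = 0 := by rw [QuadraticMap.associated_isSymm, h01]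
  have h0' a : associated Q (x a) x₀ = 0 := by rw [QuadraticMap.associated_isSymm, h0]
  have h1' a : associated Q (x a) x₁ = 0 := by rw [QuadraticMap.associated_isSymm, h1]
  intro a b
  refine Fin.cases ?_ (Fin.cases ?_ fun a => ?_) a <;>
  refine Fin.cases ?_ (Fin.cases ?_ fun b => ?_) b <;>
  simp only [Fin.cons_zero, Fin.cons_succ, h00, h11, h01, h10, h0, h1, h0', h1', hx,
    Fin.succ_inj, Fin.succ_ne_zero, (Fin.succ_ne_zero _).symm, if_true, if_false]

namespace IsLorentzFrame

variable {v u : Fin (n + 1) → V}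

theorem isOrtho (hv : IsLorentzFrame Q v) : Pairwise fun i j => Q.IsOrtho (v i) (v j) :=
  fun i j hij => QuadraticMap.associated_isOrtho.1 ((hv i j).trans (if_neg hij))

theorem vecAct (hv : IsLorentzFrame Q v) (g : spinGroup Q) :
    IsLorentzFrame Q fun i => vecAct Q g (v i) := fun i j => by
  rw [associated_vecAct, hv]

theorem apply_ne_zero (hv : IsLorentzFrame Q v) (i : Fin (n + 1)) : Q (v i) ≠ 0 := by
  rw [← QuadraticMap.associated_eq_self_apply ℝ Q, hv, if_pos rfl]
  split_ifs <;> norm_num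

theorem apply_zero (hv : IsLorentzFrame Q v) : Q (v 0) = -1 := by
  rw [← QuadraticMap.associated_eq_self_apply ℝ Q, hv, if_pos rfl, if_pos rfl]

theorem update_neg (hv : IsLorentzFrame Q v) (i : Fin (n + 1)) :
    IsLorentzFrame Q (Function.update v i (-v i)) := by
  intro a b
  rw [← hv]
  by_cases ha : a = i <;> by_cases hb : b = i
  · rw [ha, hb, Function.update_self, map_neg, map_neg, LinearMap.neg_apply, neg_neg]
  · rw [ha, Function.update_self, Function.update_of_ne hb, map_neg, LinearMap.neg_apply, hv,
      if_neg (Ne.symm hb), neg_zero]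
  · rw [hb, Function.update_self, Function.update_of_ne ha, map_neg, hv, if_neg ha, neg_zero]
  · rw [Function.update_of_ne ha, Function.update_of_ne hb]

theorem reflect (hv : IsLorentzFrame Q v) {d : V} (hd : Q d ≠ 0) :
    IsLorentzFrame Q fun i => v i - (2 * associated Q (v i) d / Q d) • d := by
  intro a b
  rw [← hv]
  simp only [map_sub, map_smul, LinearMap.sub_apply, LinearMap.smul_apply, smul_eq_mul,
    QuadraticMap.associated_isSymm ℝ Q d, QuadraticMap.associated_eq_self_apply]
  field_simp
  ring

theorem ιMulti_eq_or_eq_neg (hv : IsLorentzFrame Q v) (hu : IsLorentzFrame Q u)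
    (h : ∀ i, u i ∈ Submodule.span ℝ (Set.range v)) :
    ιMulti ℝ (n + 1) u = ιMulti ℝ (n + 1) v ∨ ιMulti ℝ (n + 1) u = -ιMulti ℝ (n + 1) v := by
  refine alternatingMap_eq_or_eq_neg_of_gram_eq (associated Q) h
    (fun i j => by rw [hu, hv]) ?_ _
  have hJ : (Matrix.of fun i j => associated Q (v i) (v j)) =
      Matrix.diagonal fun i => if i = 0 then -1 else 1 := Matrix.ext (hv · ·)
  rw [hJ, Matrix.det_diagonal, Finset.prod_ne_zero_iff]
  intro i _
  split_ifs <;> norm_num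

-- The reflection in `v 0 + v 1 - x` exchanges the null vectors `v 0 + v 1` and `x`.
theorem exists_add_eq {v : Fin (n + 2) → V} (hv : IsLorentzFrame Q v) {x : V} (hx0 : Q x = 0)
    (h : associated Q (v 0 + v 1) x ≠ 0) {S : Submodule ℝ V} (hvS : ∀ i, v i ∈ S)
    (hxS : x ∈ S) : ∃ u : Fin (n + 2) → V, IsLorentzFrame Q u ∧ u 0 + u 1 = x ∧ ∀ i, u i ∈ S := by
  set d := v 0 + v 1 - x with hd
  have hkk : associated Q (v 0 + v 1) (v 0 + v 1) = 0 := by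
    simp only [map_add, LinearMap.add_apply, hv _ _]
    simp
  have hkd : associated Q (v 0 + v 1) d = -associated Q (v 0 + v 1) x := by
    rw [hd, map_sub, hkk, zero_sub]
  have hxx : associated Q x x = 0 := (QuadraticMap.associated_eq_self_apply ℝ Q x).trans hx0
  have hdd : Q d = 2 * associated Q (v 0 + v 1) d := by
    rw [← QuadraticMap.associated_eq_self_apply ℝ Q d, hkd, hd]
    simp only [map_sub, LinearMap.sub_apply, hkk, hxx,
      QuadraticMap.associated_isSymm ℝ Q x (v 0 + v 1)]
    ring
  have hd0 : Q d ≠ 0 := by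
    rw [hdd, hkd]
    exact mul_ne_zero two_ne_zero (neg_ne_zero.2 h)
  refine ⟨_, hv.reflect hd0, ?_, fun i => sub_mem (hvS i) (S.smul_mem _
    (sub_mem (add_mem (hvS 0) (hvS 1)) hxS))⟩
  rw [sub_add_sub_comm, ← add_smul, ← add_div, ← mul_add, ← LinearMap.add_apply, ← map_add, ← hdd,
    div_self hd0, one_smul, hd, sub_sub_cancel]

theorem exists_add_eq_and_ιMulti_eq {v : Fin (n + 3) → V} (hv : IsLorentzFrame Q v) {x : V}
    (hx : x ∈ Submodule.span ℝ (Set.range v)) (hx0 : Q x = 0)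
    (h : associated Q (v 0) x ≠ 0) :
    ∃ u : Fin (n + 3) → V,
      IsLorentzFrame Q u ∧ u 0 + u 1 = x ∧ ιMulti ℝ (n + 3) u = ιMulti ℝ (n + 3) v := by
  have hmem i : v i ∈ Submodule.span ℝ (Set.range v) := Submodule.mem_span_of_mem ⟨i, rfl⟩
  obtain ⟨u, hu, hux, huS⟩ : ∃ u : Fin (n + 3) → V, IsLorentzFrame Q u ∧ u 0 + u 1 = x ∧
      ∀ i, u i ∈ Submodule.span ℝ (Set.range v) := by
    by_cases hplus : associated Q (v 0 + v 1) x = 0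
    · refine (hv.update_neg 1).exists_add_eq hx0 (fun hminus => h ?_) (fun i => ?_) hx
      · rw [Function.update_self, Function.update_of_ne (by simp)] at hminus
        simp only [map_add, map_neg, LinearMap.add_apply, LinearMap.neg_apply] at hplus hminus
        linarith
      · rcases eq_or_ne i 1 with rfl | hi
        · exact Function.update_self (1 : Fin (n + 3)) (-v 1) v ▸ neg_mem (hmem 1)
        · exact Function.update_of_ne hi (-v 1) v ▸ hmem i
    · exact hv.exists_add_eq hx0 hplus hmem hx
  rcases hv.ιMulti_eq_or_eq_neg hu huS with he | he
  · exact ⟨u, hu, hux, he⟩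
  · refine ⟨_, hu.update_neg (Fin.last _), ?_, ?_⟩
    · rwa [Function.update_of_ne Fin.last_pos.ne, Function.update_of_ne Fin.one_lt_last.ne]
    · rw [AlternatingMap.map_update_neg, Function.update_eq_self, he, neg_neg]

end IsLorentzFrame

end LorentzFrames

/-! ### Minkowski space -/

/-- The projection of Minkowski space onto `𝔼⁸`, the left inverse of `incl8`. -/
def proj8 : Mink →ₗ[ℝ] (Fin 8 → ℝ) :=
  LinearMap.funLeft ℝ ℝ fun k : Fin 8 => k.castSucc.castSucc.succ

theorem proj8_apply (v : Mink) (k : Fin 8) : proj8 v k = v k.castSucc.castSucc.succ :=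
  rfl

theorem proj8_incl8 (x : Fin 8 → ℝ) : proj8 (incl8 x) = x :=
  funext fun k => incl8_mid x k

theorem minkInner_eq_sum (x y : Mink) :
    minkInner x y = -(x 0 * y 0) + ∑ i : Fin 10, x i.succ * y i.succ := by
  rw [minkInner, Fin.sum_univ_succ]
  simp [minkSign]

theorem minkInner_eq (x y : Mink) : minkInner x y =
    -(x 0 * y 0) + proj8 x ⬝ᵥ proj8 y + x 9 * y 9 + x 10 * y 10 := by
  have h0 : minkSign 0 = -1 := rfl
  have hs (i : Fin 10) : minkSign i.succ = 1 := Fin.cons_succ _ _ i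
  have h9 : minkSign 9 = 1 := hs 8
  have h10 : minkSign 10 = 1 := hs 9
  rw [minkInner, sum_eleven]
  simp only [h0, hs, h9, h10, one_mul, neg_one_mul, dotProduct, proj8_apply]

theorem associated_quad11 (x y : Mink) : associated quad11 x y = minkInner x y := by
  rw [QuadraticMap.associated_apply, ← QuadraticMap.polar, polar_quad11]
  simp

theorem isOrtho_iff_minkInner_eq_zero {x y : Mink} :
    quad11.IsOrtho x y ↔ minkInner x y = 0 := by
  rw [← QuadraticMap.associated_isOrtho, associated_quad11]

theorem minkInner_vecAct (g : spinGroup quad11) (v w : Mink) :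
    minkInner (vecAct quad11 g v) (vecAct quad11 g w) = minkInner v w := by
  rw [← associated_quad11, associated_vecAct, associated_quad11]

theorem minkInner_incl8 (x y : Fin 8 → ℝ) : minkInner (incl8 x) (incl8 y) = x ⬝ᵥ y := by
  simp only [minkInner_eq, proj8_incl8, incl8_zero, incl8_nine, incl8_nat, mul_zero, neg_zero,
    zero_add, add_zero]

theorem minkInner_stdVec_zero (x : Mink) : minkInner (stdVec 0) x = -x 0 := by
  rw [minkInner, Finset.sum_eq_single 0 (fun M _ hM => by simp [stdVec, hM]) (by simp)]
  simp [stdVec, minkSign]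

theorem minkInner_stdVec_of_ne_zero {M : Fin 11} (hM : M ≠ 0) (x : Mink) :
    minkInner (stdVec M) x = x M := by
  obtain ⟨M, rfl⟩ := Fin.exists_succ_eq.2 hM
  rw [minkInner, Finset.sum_eq_single M.succ (fun M' _ hM' => by simp [stdVec, hM']) (by simp)]
  simp [stdVec, minkSign]

theorem inE9_iff {c : Mink} :
    InE9 c ↔ minkInner (stdVec 0) c = 0 ∧ minkInner (stdVec 9) c = 0 := by
  rw [minkInner_stdVec_zero, minkInner_stdVec_of_ne_zero (by decide), neg_eq_zero, InE9]

theorem inE9_incl8 (x : Fin 8 → ℝ) : InE9 (incl8 x) :=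
  ⟨incl8_zero x, incl8_nine x⟩

theorem inE9_stdVec_ten : InE9 (stdVec 10) := by
  constructor <;> simp [stdVec]

theorem InE9.minkInner_eq_zero {c d : Mink} (hc : InE9 c)
    (hd : d ∈ Submodule.span ℝ {stdVec 0, stdVec 9}) : minkInner d c = 0 := by
  obtain ⟨a, b, rfl⟩ := Submodule.mem_span_pair.1 hd
  have h := inE9_iff.1 hc
  simp only [← associated_quad11, map_add, map_smul, LinearMap.add_apply,
    LinearMap.smul_apply] at h ⊢
  rw [h.1, h.2, smul_zero, smul_zero, add_zero]

/-! ### Branes -/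

theorem isPlane51_iff {p : ExteriorAlgebra ℝ Mink} :
    IsPlane51 p ↔ ∃ v : Fin 6 → Mink, IsLorentzFrame quad11 v ∧ p = ιMulti ℝ 6 v := by
  simp only [IsPlane51, IsLorentzFrame, associated_quad11]

theorem IsPlane51.spinAct {p : ExteriorAlgebra ℝ Mink} (hp : IsPlane51 p)
    (g : spinGroup quad11) : IsPlane51 (spinAct quad11 g p) := by
  obtain ⟨v, hv, rfl⟩ := isPlane51_iff.1 hp
  exact isPlane51_iff.2 ⟨_, hv.vecAct g, spinAct_ιMulti g hv.isOrtho⟩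

/-- The orthonormal basis `e₀, e₉, x₁, …, x₄` of a `(5,1)`-plane that contains `e₀` and `e₉`. -/
def braneFrame (x : Fin 4 → Mink) : Fin 6 → Mink :=
  Fin.cons (stdVec 0) (Fin.cons (stdVec 9) x)

theorem isLorentzFrame_braneFrame {x : Fin 4 → Mink}
    (hx : ∀ a b, minkInner (x a) (x b) = if a = b then 1 else 0) (h9 : ∀ a, InE9 (x a)) :
    IsLorentzFrame quad11 (braneFrame x) := by
  apply isLorentzFrame_cons <;> simp only [associated_quad11]
  · rw [minkInner_stdVec_zero]
    simp [stdVec]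
  · rw [minkInner_stdVec_of_ne_zero (by decide)]
    simp [stdVec]
  · rw [minkInner_stdVec_zero]
    simp [stdVec]
  · exact fun a => (inE9_iff.1 (h9 a)).1
  · exact fun a => (inE9_iff.1 (h9 a)).2
  · exact hx

section Branes

variable {w : Fin 4 → Fin 8 → ℝ} {ζ : ExteriorAlgebra ℝ (Fin 8 → ℝ)}

theorem brane_ιMulti (w : Fin 4 → Fin 8 → ℝ) :
    brane (ιMulti ℝ 4 w) = ιMulti ℝ 6 (braneFrame fun i => incl8 (w i)) := by
  rw [brane_eq, ExteriorAlgebra.map_apply_ιMulti, ExteriorAlgebra.ιMulti_succ_apply,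
    ExteriorAlgebra.ιMulti_succ_apply, mul_assoc]
  rfl

theorem IsFrame8.isLorentzFrame (hw : IsFrame8 w) :
    IsLorentzFrame quad11 (braneFrame fun i => incl8 (w i)) :=
  isLorentzFrame_braneFrame (fun a b => (minkInner_incl8 _ _).trans (hw a b))
    fun _ => inE9_incl8 _

theorem isPlane51_brane (hζ : IsPlane8 ζ) : IsPlane51 (brane ζ) := by
  obtain ⟨w, hw, rfl⟩ := hζ
  exact isPlane51_iff.2 ⟨_, hw.isLorentzFrame, brane_ιMulti w⟩

theorem cliffEmb_ι_mul_ι_mul (x y : Fin 8 → ℝ) (z : CliffordAlgebra quad8) :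
    cliffEmb (ι quad8 x * (ι quad8 y * z)) =
      -(ι quad11 (incl8 x) * (ι quad11 (incl8 y) * cliffEmb z)) := by
  calc cliffEmb (ι quad8 x * (ι quad8 y * z))
      = ι quad11 (incl8 x) * (ι quad11 (stdVec 10) * ι quad11 (incl8 y)) *
          ι quad11 (stdVec 10) * cliffEmb z := by
        simp only [map_mul, cliffEmb_ι, mul_assoc]
    _ = -(ι quad11 (incl8 x) * (ι quad11 (incl8 y) *
          ((ι quad11 (stdVec 10) * ι quad11 (stdVec 10)) * cliffEmb z))) := by
        simp only [incl8_nat_anti, mul_assoc, neg_mul, mul_neg]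
    _ = -(ι quad11 (incl8 x) * (ι quad11 (incl8 y) * cliffEmb z)) := by rw [nat_sq, one_mul]

theorem toCliff_brane (hζ : IsPlane8 ζ) :
    toCliff quad11 (brane ζ) =
      ι quad11 (stdVec 0) * (ι quad11 (stdVec 9) * cliffEmb (toCliff quad8 ζ)) := by
  obtain ⟨w, hw, rfl⟩ := hζ
  rw [brane_ιMulti, toCliff_ιMulti_of_isOrtho hw.isLorentzFrame.isOrtho,
    toCliff_ιMulti_of_isOrtho hw.isOrtho, braneFrame, List.ofFn_cons, List.ofFn_cons]
  simp only [List.ofFn_succ, List.ofFn_zero, List.map_cons, List.map_nil, List.prod_cons,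
    List.prod_nil, cliffEmb_ι_mul_ι_mul, map_one, mul_neg, neg_neg]

theorem mulVec_stdVec_zero_mulVec_stdVec_nine {ε : Idx32 → ℝ} (hε : ε ∈ deltaPrime) :
    rho11 (ι quad11 (stdVec 0)) *ᵥ (rho11 (ι quad11 (stdVec 9)) *ᵥ ε) = ε := by
  have h : rho11 (ι quad11 ePlus) *ᵥ ε = 0 := hε
  rw [ePlus, map_add, map_add, Matrix.add_mulVec] at h
  rw [eq_neg_of_add_eq_zero_right h, Matrix.mulVec_neg, ι_mulVec_ι_mulVec, quad11_apply,
    minkInner_stdVec_zero]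
  simp [stdVec]

theorem mem_susy_brane_iff (hζ : IsPlane8 ζ) {φ : Idx16 → ℝ} :
    spinorIncl φ ∈ susy rho11 (brane ζ) ↔ φ ∈ susy rho8 ζ := by
  have h : rho11 (toCliff quad11 (brane ζ)) *ᵥ spinorIncl φ =
      spinorIncl (rho8 (toCliff quad8 ζ) *ᵥ φ) := by
    rw [toCliff_brane hζ, map_mul, map_mul, ← Matrix.mulVec_mulVec, ← Matrix.mulVec_mulVec,
      ← spinorIncl_mulVec]
    exact mulVec_stdVec_zero_mulVec_stdVec_nine (ePlus_mulVec_spinorIncl _)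
  change rho11 (toCliff quad11 (brane ζ)) *ᵥ spinorIncl φ = spinorIncl φ ↔ _
  rw [h, spinorIncl_injective.eq_iff]
  rfl

end Branes

/-! ### `Cl₈` embeds in `Cl₁,₁₀` -/

/-- The action of the vectors of Minkowski space on `Cl₈ ⊕ Cl₈` that is given by the same block
matrices as the action on `Δ`, with the main involution in the role of the chirality operator. -/
def doubleCliffVec : Mink →ₗ[ℝ] Module.End ℝ (CliffordAlgebra quad8 × CliffordAlgebra quad8) :=
  LinearMap.mk₂ ℝ (fun v p =>
    (v 10 • p.1 + v 9 • p.2 - ι quad8 (proj8 v) * p.2 - v 0 • involute p.2,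
      v 9 • p.1 + ι quad8 (proj8 v) * p.1 + v 0 • involute p.1 - v 10 • p.2))
    (fun v w p => by
      ext1 <;> simp only [Pi.add_apply, map_add, add_smul, add_mul, Prod.fst_add, Prod.snd_add] <;>
      abel)
    (fun r v p => by
      ext1 <;> simp only [Pi.smul_apply, map_smul, smul_mul_assoc, Prod.smul_fst, Prod.smul_snd,
        smul_add, smul_sub, smul_eq_mul, mul_smul])
    (fun v p q => by
      ext1 <;> simp only [map_add, mul_add, smul_add, Prod.fst_add, Prod.snd_add] <;> abel)
    (fun r v p => by
      ext1 <;> simp only [map_smul, mul_smul_comm, Prod.smul_fst, Prod.smul_snd, smul_add,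
        smul_sub, smul_comm r])

theorem doubleCliffVec_apply (v : Mink) (a b : CliffordAlgebra quad8) :
    doubleCliffVec v (a, b) =
      (v 10 • a + v 9 • b - ι quad8 (proj8 v) * b - v 0 • involute b,
        v 9 • a + ι quad8 (proj8 v) * a + v 0 • involute a - v 10 • b) :=
  rfl

theorem doubleCliffVec_sq (v : Mink) :
    doubleCliffVec v * doubleCliffVec v = algebraMap ℝ _ (quad11 v) := by
  have hq : quad11 v = -(v 0 * v 0) - quad8 (proj8 v) + v 9 * v 9 + v 10 * v 10 := by
    rw [quad11_apply, minkInner_eq, quad8_apply]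
    simp only [dotProduct]
    ring
  have hX (a) : ι quad8 (proj8 v) * (ι quad8 (proj8 v) * a) = quad8 (proj8 v) • a := by
    rw [← mul_assoc, CliffordAlgebra.ι_sq_scalar, Algebra.smul_def]
  refine LinearMap.ext fun ⟨a, b⟩ => ?_
  rw [Module.End.mul_apply, doubleCliffVec_apply, doubleCliffVec_apply,
    Module.algebraMap_end_apply, hq]
  ext1 <;>
  simp only [map_add, map_sub, map_smul, map_mul, CliffordAlgebra.involute_ι,
    CliffordAlgebra.involute_involute, mul_add, mul_sub, mul_smul_comm, neg_mul, hX,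
    Prod.smul_fst, Prod.smul_snd] <;>
  module

/-- The action of `Cl₁,₁₀` on `Cl₈ ⊕ Cl₈`; it shows that `Cl₈` embeds in `Cl₁,₁₀`. -/
def doubleCliff : CliffordAlgebra quad11 →ₐ[ℝ]
    Module.End ℝ (CliffordAlgebra quad8 × CliffordAlgebra quad8) :=
  CliffordAlgebra.lift quad11 ⟨doubleCliffVec, doubleCliffVec_sq⟩

theorem doubleCliff_ι (v : Mink) : doubleCliff (ι quad11 v) = doubleCliffVec v :=
  CliffordAlgebra.lift_ι_apply _ _ v

theorem proj8_stdVec_ten : proj8 (stdVec 10) = 0 := by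
  funext k
  have hk : k.castSucc.castSucc.succ ≠ (10 : Fin 11) := by
    revert k
    decide
  rw [proj8_apply, stdVec, Pi.single_eq_of_ne hk, Pi.zero_apply]

theorem doubleCliff_cliffEmb (x a : CliffordAlgebra quad8) :
    doubleCliff (cliffEmb x) (a, a) = (x * a, x * a) := by
  induction x using CliffordAlgebra.induction generalizing a with
  | algebraMap r =>
    rw [AlgHom.commutes, AlgHom.commutes, Module.algebraMap_end_apply, ← Algebra.smul_def]
    rfl
  | ι x =>
    rw [cliffEmb_ι, map_mul, Module.End.mul_apply, doubleCliff_ι, doubleCliff_ι,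
      doubleCliffVec_apply, doubleCliffVec_apply, proj8_incl8, incl8_zero, incl8_nine, incl8_nat,
      proj8_stdVec_ten, map_zero]
    simp [stdVec]
  | mul y z hy hz => rw [map_mul, map_mul, Module.End.mul_apply, hz, hy, mul_assoc]
  | add y z hy hz =>
    rw [map_add, map_add, LinearMap.add_apply, hy, hz, add_mul]
    rfl

theorem cliffEmb_injective : Function.Injective cliffEmb := fun x y h => by
  have h1 := congrArg (fun z => (doubleCliff z (1, 1)).1) h
  simpa only [doubleCliff_cliffEmb, mul_one] using h1

theorem spinEmb_injective : Function.Injective spinEmb := fun _ _ h =>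
  Subtype.ext (cliffEmb_injective (congrArg Subtype.val h))

/-! ### The action of `Spin₈` on branes and on null rotations -/

section SpinEight

variable {ζ : ExteriorAlgebra ℝ (Fin 8 → ℝ)} {c : Mink}

theorem commute_ι_cliffEmb (hc : c ∈ Submodule.span ℝ {stdVec 0, stdVec 9})
    (y : CliffordAlgebra quad8) : Commute (ι quad11 c) (cliffEmb y) := by
  induction y using CliffordAlgebra.induction with
  | algebraMap r =>
    rw [AlgHom.commutes]
    exact (Algebra.commutes r _).symm
  | ι x =>
    have h : Commute (ι quad11 c) (([incl8 x, stdVec 10].map (ι quad11)).prod) := by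
      refine commute_ι_prod_map_ι (fun v hv => isOrtho_iff_minkInner_eq_zero.2 ?_) even_two
      obtain rfl | rfl := List.mem_pair.1 hv
      exacts [(inE9_incl8 x).minkInner_eq_zero hc, inE9_stdVec_ten.minkInner_eq_zero hc]
    simpa only [cliffEmb_ι, List.map_cons, List.map_nil, List.prod_cons, List.prod_nil,
      mul_one] using h
  | mul a b ha hb => simpa only [map_mul] using ha.mul_right hb
  | add a b ha hb => simpa only [map_add] using ha.add_right hb

theorem vecAct_spinEmb_of_mem_span (k : spinGroup quad8)
    (hc : c ∈ Submodule.span ℝ {stdVec 0, stdVec 9}) : vecAct quad11 (spinEmb k) c = c :=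
  (vecAct_eq_iff quad11 _).2 (commute_ι_cliffEmb hc _).symm

theorem stdVec_zero_mem_span : stdVec 0 ∈ Submodule.span ℝ {stdVec 0, stdVec 9} :=
  Submodule.mem_span_of_mem (Set.mem_insert _ _)

theorem stdVec_nine_mem_span : stdVec 9 ∈ Submodule.span ℝ {stdVec 0, stdVec 9} :=
  Submodule.mem_span_of_mem (Set.mem_insert_of_mem _ rfl)

theorem ePlus_mem_span : ePlus ∈ Submodule.span ℝ {stdVec 0, stdVec 9} :=
  add_mem stdVec_zero_mem_span stdVec_nine_mem_span

theorem spinConj_spinEmb_cliffEmb (k : spinGroup quad8) (y : CliffordAlgebra quad8) :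
    spinConj quad11 (spinEmb k) (cliffEmb y) = cliffEmb (spinConj quad8 k y) := by
  rw [spinConj_eq_iff]
  change cliffEmb k * cliffEmb y = _ * cliffEmb k
  rw [← map_mul, ← map_mul, (spinConj_eq_iff quad8 k).1 rfl]

theorem brane_spinAct (hζ : IsPlane8 ζ) (k : spinGroup quad8) :
    brane (spinAct quad8 k ζ) = spinAct quad11 (spinEmb k) (brane ζ) := by
  apply (toCliff quad11).injective
  rw [toCliff_brane (hζ.spinAct k), toCliff_spinAct, toCliff_spinAct, toCliff_brane hζ, map_mul,
    map_mul, spinConj_spinEmb_cliffEmb, ← ι_vecAct, ← ι_vecAct,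
    vecAct_spinEmb_of_mem_span k stdVec_zero_mem_span,
    vecAct_spinEmb_of_mem_span k stdVec_nine_mem_span]

theorem InE9.vecAct_spinEmb (hc : InE9 c) (k : spinGroup quad8) :
    InE9 (vecAct quad11 (spinEmb k) c) := by
  have h0 := minkInner_vecAct (spinEmb k) (stdVec 0) c
  have h9 := minkInner_vecAct (spinEmb k) (stdVec 9) c
  rw [vecAct_spinEmb_of_mem_span k stdVec_zero_mem_span] at h0
  rw [vecAct_spinEmb_of_mem_span k stdVec_nine_mem_span] at h9
  rw [inE9_iff] at hc ⊢
  rwa [h0, h9]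

theorem spinConj_nullRot {g : spinGroup quad11} (hg : vecAct quad11 g ePlus = ePlus) (c : Mink) :
    spinConj quad11 g (nullRot c) = nullRot (vecAct quad11 g c) := by
  rw [nullRot, nullRot, map_add, map_one, map_smul, map_mul, ← ι_vecAct, ← ι_vecAct, hg]

theorem conj_mem_nullRotations (k : spinGroup quad8) {r : spinGroup quad11}
    (hr : r ∈ nullRotations) : spinEmb k * r * (spinEmb k)⁻¹ ∈ nullRotations := by
  obtain ⟨c, hc, hr⟩ := hr
  refine ⟨vecAct quad11 (spinEmb k) c, hc.vecAct_spinEmb k, ?_⟩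
  rw [← spinConj_nullRot (vecAct_spinEmb_of_mem_span k ePlus_mem_span), spinConj_apply, ← hr]
  rfl

end SpinEight

/-! ### Orbits of semidirect products -/

section Reduction

variable {K : Subgroup (spinGroup quad8)} {N G : Subgroup (spinGroup quad11)}
  {ζ : ExteriorAlgebra ℝ (Fin 8 → ℝ)}

theorem spinorIncl_mem_invariants_iff {φ : Idx16 → ℝ} :
    spinorIncl φ ∈ invariants rho11 (K.map spinEmb) ↔ φ ∈ invariants rho8 K := by
  have h (k : spinGroup quad8) : rho11 (spinEmb k : CliffordAlgebra quad11) *ᵥ spinorIncl φ =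
      spinorIncl (rho8 (k : CliffordAlgebra quad8) *ᵥ φ) := (spinorIncl_mulVec _ φ).symm
  refine ⟨fun hφ k hk => spinorIncl_injective ?_, ?_⟩
  · rw [← h, hφ _ ⟨k, hk, rfl⟩]
  · rintro hφ _ ⟨k, hk, rfl⟩
    rw [h, hφ k hk]

theorem invariants_inf_susy_brane (hN : N ≤ nullRotations) (hN1 : N ≠ ⊥) (hζ : IsPlane8 ζ) :
    invariants rho11 (K.map spinEmb ⊔ N) ⊓ susy rho11 (brane ζ) =
      (invariants rho8 K ⊓ susy rho8 ζ).map spinorIncl := by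
  rw [invariants_sup, invariants_eq_deltaPrime hN hN1, ← range_spinorIncl]
  ext ε
  constructor
  · rintro ⟨⟨h, φ, rfl⟩, hε⟩
    exact ⟨φ, ⟨spinorIncl_mem_invariants_iff.1 h, (mem_susy_brane_iff hζ).1 hε⟩, rfl⟩
  · rintro ⟨φ, ⟨h, hφ⟩, rfl⟩
    exact ⟨⟨spinorIncl_mem_invariants_iff.2 h, φ, rfl⟩, (mem_susy_brane_iff hζ).2 hφ⟩

variable {ι : Type*} {p : ι → ExteriorAlgebra ℝ Mink} {r : ι → spinGroup quad11}
  {z : ι → ExteriorAlgebra ℝ (Fin 8 → ℝ)}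

theorem SameOrbit.spinAct_brane (h : SameOrbit quad8 K z) (hz : ∀ i, IsPlane8 (z i))
    (hr : ∀ i, r i ∈ N) :
    SameOrbit quad11 (K.map spinEmb ⊔ N) fun i => spinAct quad11 (r i) (brane (z i)) := by
  intro i j
  obtain ⟨k, hk, hkz⟩ := h i j
  have hN {x} (hx : x ∈ N) : x ∈ K.map spinEmb ⊔ N := Subgroup.mem_sup_right hx
  refine ⟨r j * spinEmb k * (r i)⁻¹, mul_mem (mul_mem (hN (hr j))
    (Subgroup.mem_sup_left ⟨k, hk, rfl⟩)) (inv_mem (hN (hr i))), ?_⟩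
  simp only [spinAct_mul, (spinAct_inv_eq_iff quad11 _ _ _).2 rfl]
  rw [← brane_spinAct (hz i), hkz]

theorem SameOrbit.exists_eq_spinAct_brane (hp : SameOrbit quad11 (K.map spinEmb ⊔ N) p)
    (hKN : ∀ k ∈ K.map spinEmb, ∀ x ∈ N, k * x * k⁻¹ ∈ N) (hζ : IsPlane8 ζ)
    {r₀ : spinGroup quad11} (hr₀ : r₀ ∈ N) {i₀ : ι} (h₀ : p i₀ = spinAct quad11 r₀ (brane ζ)) :
    ∃ (r : ι → spinGroup quad11) (z : ι → ExteriorAlgebra ℝ (Fin 8 → ℝ)), z i₀ = ζ ∧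
      SameOrbit quad8 K z ∧
        ∀ i, r i ∈ N ∧ IsPlane8 (z i) ∧ p i = spinAct quad11 (r i) (brane (z i)) := by
  have h i : ∃ r ∈ N, ∃ k ∈ K, (i = i₀ → k = 1) ∧
      p i = spinAct quad11 r (brane (spinAct quad8 k ζ)) := by
    by_cases hi : i = i₀
    · exact ⟨r₀, hr₀, 1, one_mem K, fun _ => rfl, by rw [spinAct_one, hi, h₀]⟩
    · obtain ⟨g, hg, e⟩ := hp i₀ i
      obtain ⟨x, hx, _, ⟨k, hk, rfl⟩, hxk⟩ := exists_mul_eq_of_mem_sup hKN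
        (mul_mem hg (Subgroup.mem_sup_right hr₀))
      exact ⟨x, hx, k, hk, fun hi' => absurd hi' hi, by
        rw [brane_spinAct hζ, ← spinAct_mul, hxk, spinAct_mul, ← h₀, e]⟩
  choose r hr k hk hk₀ hrk using h
  have hz₀ : spinAct quad8 (k i₀) ζ = ζ := by rw [hk₀ i₀ rfl, spinAct_one]
  exact ⟨r, fun i => spinAct quad8 (k i) ζ, hz₀,
    (sameOrbit_iff_exists i₀).2 fun i => ⟨k i, hk i, by rw [hz₀]⟩,
    fun i => ⟨hr i, hζ.spinAct (k i), hrk i⟩⟩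

theorem Related.of_spinAct_brane (hG : IsSemidirect (K.map spinEmb) N G)
    (hp : Related quad11 G fun i => spinAct quad11 (r i) (brane (z i)))
    (hz : ∀ i, IsPlane8 (z i)) (hr : ∀ i, r i ∈ N) (h : SameOrbit quad8 K z) :
    Related quad8 K z := by
  refine ⟨h, fun K' hK' h' => Subgroup.map_injective spinEmb_injective ?_⟩
  have hmap : K'.map spinEmb ≤ K.map spinEmb := Subgroup.map_mono hK'
  exact hG.eq_of_le_of_sup_eq hmap
    (hp.2 _ (hG.1 ▸ sup_le_sup_right hmap N) (h'.spinAct_brane hz hr))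

end Reduction

/-! ### Spinors preserved by a Lorentzian plane -/

section LorentzianPlanes

theorem eq_zero_of_isOrtho_of_neg {v b : Mink} (hv : quad11 v < 0) (hvb : quad11.IsOrtho v b)
    (hb : quad11 b = 0) : b = 0 := by
  rw [isOrtho_iff_minkInner_eq_zero, minkInner_eq_sum] at hvb
  rw [quad11_apply, minkInner_eq_sum] at hv hb
  set S := ∑ i : Fin 10, b i.succ * b i.succ
  set U := ∑ i : Fin 10, v i.succ * v i.succ
  have hcs : (v 0 * b 0) ^ 2 ≤ U * S := by
    rw [neg_add_eq_zero.1 hvb]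
    simpa only [sq] using Finset.sum_mul_sq_le_sq_mul_sq Finset.univ
      (fun i : Fin 10 => v i.succ) fun i => b i.succ
  have hb0 : b 0 * b 0 = S := neg_add_eq_zero.1 hb
  have hS : S = 0 := by
    have hle : (v 0 * v 0 - U) * S ≤ 0 := by
      rw [sub_mul, ← hb0]
      linarith [hb0 ▸ hcs, mul_pow (v 0) (b 0) 2]
    have hpos : 0 < v 0 * v 0 - U := by linarith
    exact le_antisymm (nonpos_of_mul_nonpos_right hle hpos) (hb0 ▸ mul_self_nonneg (b 0))
  have hspace := (Finset.sum_eq_zero_iff_of_nonneg fun i _ => mul_self_nonneg (b i.succ)).1 hS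
  exact funext <| Fin.cases (mul_self_eq_zero.1 (hb0.trans hS)) fun i =>
    mul_self_eq_zero.1 (hspace i (Finset.mem_univ i))

variable {m : ℕ} {v : Fin (m + 1) → Mink} {n : Type*} [Fintype n] [DecidableEq n]
  {ρ : CliffordAlgebra quad11 →ₐ[ℝ] Matrix n n ℝ} {ε : n → ℝ} {c : Mink}

theorem mem_span_of_mem_susy (hv : IsLorentzFrame quad11 v) (hm : Even (m + 1)) (hε0 : ε ≠ 0)
    (hε : ε ∈ susy ρ (ιMulti ℝ (m + 1) v)) (hc : ρ (ι quad11 c) *ᵥ ε = 0) :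
    c ∈ Submodule.span ℝ (Set.range v) := by
  obtain ⟨a, ha, hca⟩ := exists_mem_span_isOrtho_sub hv.isOrtho hv.apply_ne_zero c
  have haε : ρ (ι quad11 a) *ᵥ ε = 0 := by
    refine ι_mulVec_eq_zero_of_add hv.isOrtho hm hε ha hca (s := 0) ?_
    rw [add_sub_cancel, hc, zero_smul]
  have hnull : quad11 (c - a) = 0 := by
    refine eq_zero_of_ι_mulVec_eq_zero ρ hε0 ?_
    rw [map_sub, map_sub, Matrix.sub_mulVec, hc, haε, sub_zero]
  have h0 : quad11 (v 0) < 0 := hv.apply_zero ▸ neg_one_lt_zero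
  rwa [sub_eq_zero.1 (eq_zero_of_isOrtho_of_neg h0 (hca 0).symm hnull)]

theorem isOrtho_of_mem_susy (hv : IsLorentzFrame quad11 v) (hm : Even (m + 1)) (hε0 : ε ≠ 0)
    (hε : ε ∈ susy ρ (ιMulti ℝ (m + 1) v)) {s : ℝ} (hc : ρ (ι quad11 c) *ᵥ ε = s • ε)
    (hc0 : quad11.IsOrtho c (v 0)) (i : Fin (m + 1)) : quad11.IsOrtho c (v i) := by
  obtain ⟨a, ha, hca⟩ := exists_mem_span_isOrtho_sub hv.isOrtho hv.apply_ne_zero c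
  have hnull : quad11 a = 0 := eq_zero_of_ι_mulVec_eq_zero ρ hε0 <|
    ι_mulVec_eq_zero_of_add hv.isOrtho hm hε ha hca (by rwa [add_sub_cancel])
  have ha0 : quad11.IsOrtho (v 0) a := by
    have h := hca 0
    rw [← QuadraticMap.associated_isOrtho] at h hc0 ⊢
    rw [map_sub, LinearMap.sub_apply, hc0, zero_sub, neg_eq_zero] at h
    rw [QuadraticMap.associated_isSymm, h]
  have h0 : quad11 (v 0) < 0 := hv.apply_zero ▸ neg_one_lt_zero
  rw [eq_zero_of_isOrtho_of_neg h0 ha0 hnull, sub_zero] at hca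
  exact hca i

end LorentzianPlanes

/-! ### Null rotations of frames -/

theorem minkInner_ePlus (x : Mink) : minkInner ePlus x = x 9 - x 0 := by
  rw [← associated_quad11, ePlus, map_add, LinearMap.add_apply, associated_quad11,
    associated_quad11, minkInner_stdVec_zero, minkInner_stdVec_of_ne_zero (by decide)]
  ring

theorem minkInner_eMinus (x : Mink) : minkInner eMinus x = -x 0 - x 9 := by
  rw [← associated_quad11, eMinus, map_sub, LinearMap.sub_apply, associated_quad11,
    associated_quad11, minkInner_stdVec_zero, minkInner_stdVec_of_ne_zero (by decide)]

theorem ePlus_zero : ePlus 0 = 1 := by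
  simp [ePlus, stdVec]

theorem ePlus_nine : ePlus 9 = 1 := by
  simp [ePlus, stdVec]

theorem eMinus_zero : eMinus 0 = 1 := by
  simp [eMinus, stdVec]

theorem eMinus_nine : eMinus 9 = -1 := by
  simp [eMinus, stdVec]

theorem minkInner_ePlus_eMinus : minkInner ePlus eMinus = -2 := by
  rw [minkInner_ePlus, eMinus_zero, eMinus_nine]
  norm_num

theorem quad11_eMinus : quad11 eMinus = 0 := by
  rw [quad11_apply, minkInner_eMinus, eMinus_zero, eMinus_nine]
  norm_num

theorem eMinus_mem_span : eMinus ∈ Submodule.span ℝ {stdVec 0, stdVec 9} :=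
  sub_mem stdVec_zero_mem_span stdVec_nine_mem_span

section NullRotations

variable {r : spinGroup quad11} {d f : Mink}

theorem vecAct_ePlus_of_mem_nullRotations (hr : r ∈ nullRotations) :
    vecAct quad11 r ePlus = ePlus := by
  obtain ⟨d, hd, hr⟩ := hr
  rw [vecAct_eq_iff, hr, nullRot, add_mul, mul_add, smul_mul_assoc, mul_smul_comm, mul_assoc,
    ePlus_sq, ← mul_assoc _ (ι quad11 d), ePlus_anti d hd, neg_mul, mul_assoc, ePlus_sq, mul_zero,
    neg_zero, one_mul, mul_one]

theorem vecAct_eMinus (hd : InE9 d) (hr : (r : CliffordAlgebra quad11) = nullRot d) :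
    vecAct quad11 r eMinus = eMinus - (2 : ℝ) • d + quad11 d • ePlus := by
  rw [vecAct_eq_iff, hr, nullRot, map_add, map_sub, map_smul, map_smul]
  have hpd := ePlus_anti d hd
  have hmd : ι quad11 eMinus * ι quad11 d = -(ι quad11 d * ι quad11 eMinus) :=
    CliffordAlgebra.ι_mul_ι_comm_of_isOrtho <|
      isOrtho_iff_minkInner_eq_zero.2 (hd.minkInner_eq_zero eMinus_mem_span)
  have hmp : ι quad11 eMinus * ι quad11 ePlus =
      algebraMap ℝ _ (-4) - ι quad11 ePlus * ι quad11 eMinus := by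
    rw [CliffordAlgebra.ι_mul_ι_comm, QuadraticMap.polar_comm, polar_quad11,
      minkInner_ePlus_eMinus]
    norm_num
  have hdd := CliffordAlgebra.ι_sq_scalar quad11 d
  have hpp := ePlus_sq
  set P := ι quad11 ePlus
  set M := ι quad11 eMinus
  set D := ι quad11 d
  have hMDP : M * (D * P) = (4 : ℝ) • D + D * (P * M) := by
    rw [← mul_assoc, hmd, neg_mul, mul_assoc, hmp, mul_sub, ← Algebra.commutes,
      ← Algebra.smul_def]
    module
  have hDDP : D * (D * P) = quad11 d • P := by rw [← mul_assoc, hdd, Algebra.smul_def]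
  have hPDP : P * (D * P) = 0 := by
    rw [← mul_assoc, hpd, neg_mul, mul_assoc, hpp, mul_zero, neg_zero]
  simp only [mul_add, add_mul, sub_mul, mul_one, one_mul, smul_mul_assoc, mul_smul_comm, hMDP,
    hDDP, hPDP, mul_assoc, smul_zero]
  module

theorem quad11_eMinus_add_smul_ePlus (s : ℝ) : quad11 (eMinus + s • ePlus) = -4 * s := by
  rw [QuadraticMap.map_add quad11, QuadraticMap.map_smul quad11, quad11_eMinus, quad11_ePlus,
    QuadraticMap.polar_smul_right, QuadraticMap.polar_comm, polar_quad11, minkInner_ePlus_eMinus]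
  simp only [smul_eq_mul]
  ring

theorem exists_inE9_eq_of_null (hf : quad11 f = 0) (hpf : minkInner ePlus f = -2) :
    ∃ d, InE9 d ∧ f = eMinus - (2 : ℝ) • d + quad11 d • ePlus := by
  rw [minkInner_ePlus] at hpf
  obtain ⟨d, hfd⟩ : ∃ d, f = eMinus + (f 0 - 1) • ePlus + (-2 : ℝ) • d :=
    ⟨(-1 / 2 : ℝ) • (f - eMinus - (f 0 - 1) • ePlus), by module⟩
  have hd : InE9 d := by
    have h0 := congrFun hfd 0
    have h9 := congrFun hfd 9
    simp only [Pi.add_apply, Pi.smul_apply, smul_eq_mul, ePlus_zero, ePlus_nine, eMinus_zero,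
      eMinus_nine] at h0 h9
    constructor <;> linarith
  have hq : quad11 d = f 0 - 1 := by
    have hortho : minkInner (eMinus + (f 0 - 1) • ePlus) d = 0 :=
      hd.minkInner_eq_zero (add_mem eMinus_mem_span (Submodule.smul_mem _ _ ePlus_mem_span))
    rw [hfd, QuadraticMap.map_add quad11, QuadraticMap.polar_smul_right, polar_quad11, hortho,
      quad11_eMinus_add_smul_ePlus, QuadraticMap.map_smul quad11, smul_eq_mul, mul_zero,
      smul_zero] at hf
    linarith
  refine ⟨d, hd, ?_⟩
  rw [hq, sub_add_eq_add_sub, sub_eq_add_neg, ← neg_smul]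
  exact hfd

theorem exists_mem_nullRotations_vecAct_eMinus (hf : quad11 f = 0)
    (hpf : minkInner ePlus f = -2) : ∃ r ∈ nullRotations, vecAct quad11 r eMinus = f := by
  obtain ⟨d, hd, rfl⟩ := exists_inE9_eq_of_null hf hpf
  exact ⟨⟨nullRot d, nullRot_mem d hd⟩, ⟨d, hd, rfl⟩, vecAct_eMinus hd rfl⟩

theorem exists_eq_vecAct_braneFrame {u : Fin 6 → Mink} (hu : IsLorentzFrame quad11 u)
    (h : u 0 + u 1 = ePlus) : ∃ r ∈ nullRotations, ∃ x, IsLorentzFrame quad11 (braneFrame x) ∧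
      ∀ i, u i = vecAct quad11 r (braneFrame x i) := by
  have hf : quad11 (u 0 - u 1) = 0 := by
    rw [← QuadraticMap.associated_eq_self_apply ℝ]
    simp [map_sub, LinearMap.sub_apply, hu _ _]
  have hpf : minkInner ePlus (u 0 - u 1) = -2 := by
    rw [← h, ← associated_quad11]
    simp only [map_sub, map_add, LinearMap.add_apply, hu _ _]
    norm_num
  obtain ⟨r, hr, hrf⟩ := exists_mem_nullRotations_vecAct_eMinus hf hpf
  have hrp := vecAct_ePlus_of_mem_nullRotations hr
  let x : Fin 4 → Mink := fun a => vecAct quad11 r⁻¹ (u a.succ.succ)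
  have h0 : vecAct quad11 r (stdVec 0) = u 0 := by
    have e : stdVec 0 = (1 / 2 : ℝ) • (ePlus + eMinus) := by rw [ePlus, eMinus]; module
    rw [e, map_smul, map_add, hrp, hrf, ← h]
    module
  have h9 : vecAct quad11 r (stdVec 9) = u 1 := by
    have e : stdVec 9 = (1 / 2 : ℝ) • (ePlus - eMinus) := by rw [ePlus, eMinus]; module
    rw [e, map_smul, map_sub, hrp, hrf, ← h]
    module
  have hx i : u i = vecAct quad11 r (braneFrame x i) := by
    refine Fin.cases h0.symm (fun i => Fin.cases h9.symm (fun i => ?_) i) i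
    exact (vecAct_vecAct_inv quad11 r _).symm
  refine ⟨r, hr, x, fun a b => ?_, hx⟩
  rw [← associated_vecAct r, ← hx, ← hx, hu]

end NullRotations

/-! ### Planes that preserve a null spinor -/

section NullSpinors

variable {v : Fin 6 → Mink} {x : Fin 4 → Mink} {p : ExteriorAlgebra ℝ Mink} {ε : Idx32 → ℝ}
  {ψ : Idx16 → ℝ} {c : Mink}

theorem ePlus_ne_zero : ePlus ≠ 0 := fun h => by
  simpa [ePlus_zero] using congrFun h 0

theorem exists_eq_spinAct_braneFrame (hε0 : ε ≠ 0) (hε : ε ∈ deltaPrime) (hp : IsPlane51 p)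
    (hs : ε ∈ susy rho11 p) : ∃ r ∈ nullRotations, ∃ x, IsLorentzFrame quad11 (braneFrame x) ∧
      p = spinAct quad11 r (ιMulti ℝ 6 (braneFrame x)) := by
  obtain ⟨v, hv, rfl⟩ := isPlane51_iff.1 hp
  have hmem := mem_span_of_mem_susy hv (by decide) hε0 hs hε
  have htime : associated quad11 (v 0) ePlus ≠ 0 := fun h => ePlus_ne_zero <|
    eq_zero_of_isOrtho_of_neg (hv.apply_zero ▸ neg_one_lt_zero)
      (QuadraticMap.associated_isOrtho.1 h) quad11_ePlus
  obtain ⟨u, hu, hsum, huv⟩ := hv.exists_add_eq_and_ιMulti_eq hmem quad11_ePlus htime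
  obtain ⟨r, hr, x, hx, hux⟩ := exists_eq_vecAct_braneFrame hu hsum
  exact ⟨r, hr, x, hx, by rw [spinAct_ιMulti r hx.isOrtho, ← huv, funext hux]⟩

theorem incl8_proj8 (hc : InE9 c) (h10 : c 10 = 0) : incl8 (proj8 c) = c := by
  refine funext <| Fin.cases ((incl8_zero _).trans hc.1.symm) fun i => ?_
  refine Fin.lastCases ((incl8_nat _).trans h10.symm) (fun i => ?_) i
  exact Fin.lastCases ((incl8_nine _).trans hc.2.symm) (incl8_mid (proj8 c)) i

theorem exists_braneFrame_eq (hx : IsLorentzFrame quad11 (braneFrame x))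
    (h10 : ∀ a, x a 10 = 0) : ∃ ζ, IsPlane8 ζ ∧ ιMulti ℝ 6 (braneFrame x) = brane ζ := by
  have h0 (a : Fin 4) : (0 : Fin 6) ≠ a.succ.succ := (Fin.succ_ne_zero _).symm
  have h1 (a : Fin 4) : (1 : Fin 6) ≠ a.succ.succ :=
    (Fin.succ_injective _).ne (Fin.succ_ne_zero a).symm
  have h9 a : InE9 (x a) := inE9_iff.2 ⟨isOrtho_iff_minkInner_eq_zero.1 (hx.isOrtho (h0 a)),
    isOrtho_iff_minkInner_eq_zero.1 (hx.isOrtho (h1 a))⟩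
  have hincl a : incl8 (proj8 (x a)) = x a := incl8_proj8 (h9 a) (h10 a)
  refine ⟨ιMulti ℝ 4 fun a => proj8 (x a), ⟨fun a => proj8 (x a), fun a b => ?_, rfl⟩, ?_⟩
  · calc proj8 (x a) ⬝ᵥ proj8 (x b)
        = minkInner (x a) (x b) := by rw [← minkInner_incl8, hincl, hincl]
      _ = associated quad11 (x a) (x b) := (associated_quad11 _ _).symm
      _ = if a = b then 1 else 0 := by
          simpa only [braneFrame, Fin.cons_succ, Fin.succ_inj, Fin.succ_ne_zero, if_false]
            using hx a.succ.succ b.succ.succ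
  · simp only [brane_ιMulti, hincl]

theorem stdVec_ten_mulVec_spinorIncl (hψc : chir8 *ᵥ ψ = -ψ) :
    rho11 (ι quad11 (stdVec 10)) *ᵥ spinorIncl ψ = spinorIncl ψ := by
  rw [rho11_stdVec, show (10 : Fin 11) = (Fin.last 9).succ from rfl, gamma11_nat,
    spinorIncl_apply, hψc, Matrix.fromBlocks_mulVec]
  simp

theorem exists_brane_of_mem_susy (hψ : ψ ≠ 0) (hψc : chir8 *ᵥ ψ = -ψ) (hp : IsPlane51 p)
    (hs : spinorIncl ψ ∈ susy rho11 p) : ∃ r ∈ nullRotations, ∃ ζ, IsPlane8 ζ ∧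
      p = spinAct quad11 r (brane ζ) ∧ ψ ∈ susy rho8 ζ := by
  have hε0 : spinorIncl ψ ≠ 0 := (map_ne_zero_iff _ spinorIncl_injective).2 hψ
  have hε : spinorIncl ψ ∈ deltaPrime := ePlus_mulVec_spinorIncl ψ
  obtain ⟨r, hr, x, hx, rfl⟩ := exists_eq_spinAct_braneFrame hε0 hε hp hs
  rw [mem_susy_spinAct rho11 (nullRotations_le_spinorStabilizer hε hr)] at hs
  have h10 (a : Fin 4) : x a 10 = 0 := by
    have h := isOrtho_of_mem_susy hx (by decide) hε0 hs (s := 1)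
      (by rw [stdVec_ten_mulVec_spinorIncl hψc, one_smul]) ?_ a.succ.succ
    · rwa [isOrtho_iff_minkInner_eq_zero, minkInner_stdVec_of_ne_zero (by decide)] at h
    · rw [isOrtho_iff_minkInner_eq_zero, minkInner_stdVec_of_ne_zero (by decide)]
      simp [braneFrame, stdVec]
  obtain ⟨ζ, hζ, hxζ⟩ := exists_braneFrame_eq hx h10
  rw [hxζ] at hs ⊢
  exact ⟨r, hr, ζ, hζ, rfl, (mem_susy_brane_iff hζ).1 hs⟩

end NullSpinors

section CalibratedOrbits

variable {κ : Type*} {K : Subgroup (spinGroup quad8)} {z : κ → ExteriorAlgebra ℝ (Fin 8 → ℝ)}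
  {φ : Idx16 → ℝ} {i₀ : κ}

theorem SameOrbit.isPlane8 (h : SameOrbit quad8 K z) (h₀ : IsPlane8 (z i₀)) (i : κ) :
    IsPlane8 (z i) := by
  obtain ⟨k, -, hki⟩ := h i₀ i
  exact hki ▸ h₀.spinAct k

theorem SameOrbit.isCalibrated (h : SameOrbit quad8 K z) (h₀ : IsPlane8 (z i₀))
    (hK : K ≤ spinorStabilizer rho8 φ) (hφ : φ ≠ 0) (hs : φ ∈ susy rho8 (z i₀)) (i : κ) :
    IsCalibrated (cayleyForm φ) (z i) := by
  obtain ⟨k, hk, hki⟩ := h i₀ i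
  rwa [← (h.isPlane8 h₀ i).mem_susy_iff_isCalibrated hφ, ← hki, mem_susy_spinAct rho8 (hK hk)]

end CalibratedOrbits

end

theorem mainTheorem3 {ι : Type*}
    -- a nonzero `Cl₈` spinor of negative chirality, whose isotropy group in `Spin₈` is `Spin₇`
    (ψ : Idx16 → ℝ) (hψ : ψ ≠ 0) (hψc : chir8.mulVec ψ = -ψ)
    -- `G = K ⋉ N` with `K ⊂ Spin₇`, `N ⊂ ℝ⁹` and `N` nontrivial
    (K : Subgroup (spinGroup quad8)) (hK : K ≤ spinorStabilizer rho8 ψ)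
    (N : Subgroup (spinGroup quad11)) (hN : N ≤ nullRotations) (hN1 : N ≠ ⊥)
    (G : Subgroup (spinGroup quad11)) (hG : IsSemidirect (K.map spinEmb) N G) :
    -- `Δ' = ker Γ₊ = Δ^N` is sixteen-dimensional, and it is the `Cl₈` spinor module
    (invariants rho11 N = deltaPrime ∧
      Module.finrank ℝ deltaPrime = 16 ∧
      Function.Injective spinorIncl ∧
      LinearMap.range spinorIncl = deltaPrime ∧
      ∀ (x : CliffordAlgebra quad8) (φ : Idx16 → ℝ),
        spinorIncl ((rho8 x).mulVec φ) = (rho11 (cliffEmb x)).mulVec (spinorIncl φ)) ∧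
    -- `π = -½ e₊ ∧ e₋ ∧ ζ` is a `(5,1)`-plane with `Δ^G ∩ Δ(π) = (Δ')^K ∩ Δ'(ζ)`
    (∀ ζ, IsPlane8 ζ →
      IsPlane51 (brane ζ) ∧
      invariants rho11 G ⊓ susy rho11 (brane ζ) =
        (invariants rho8 K ⊓ susy rho8 ζ).map spinorIncl) ∧
    -- `ζ · φ = φ` if and only if `ζ` is calibrated by the form built by squaring `φ`
    (∀ ζ, IsPlane8 ζ → ∀ φ : Idx16 → ℝ, φ ≠ 0 →
      (φ ∈ susy rho8 ζ ↔ IsCalibrated (cayleyForm φ) ζ)) ∧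
    -- families of planes in the `G`-orbit of `π` are null-rotated families in the `K`-orbit of `ζ`
    (∀ ζ, IsPlane8 ζ → ∀ (p : ι → ExteriorAlgebra ℝ Mink) (i₀ : ι), p i₀ = brane ζ →
      SameOrbit quad11 G p →
      (∃ (r : ι → spinGroup quad11) (z : ι → ExteriorAlgebra ℝ (Fin 8 → ℝ)),
        z i₀ = ζ ∧
        (∀ i, r i ∈ N ∧ IsPlane8 (z i) ∧ p i = spinAct quad11 (r i) (brane (z i))) ∧
        SameOrbit quad8 K z ∧
        (Related quad11 G p → Related quad8 K z) ∧
        ∀ φ ∈ invariants rho8 K ⊓ susy rho8 ζ, φ ≠ 0 → ∀ i, IsCalibrated (cayleyForm φ) (z i)) ∧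
      (∀ i, IsPlane51 (p i)) ∧
      invariants rho11 G ⊓ susy rho11 (brane ζ) ≤ ⨅ i, susy rho11 (p i) ∧
      (invariants rho11 G ⊓ susy rho11 (brane ζ) ≠ ⊥ →
        ∃ φ ∈ invariants rho8 K ⊓ susy rho8 ζ, φ ≠ 0 ∧
          (chir8.mulVec φ = φ ∨ chir8.mulVec φ = -φ))) ∧
    -- and conversely
    (∀ ζ, IsPlane8 ζ → ∀ (r : ι → spinGroup quad11) (z : ι → ExteriorAlgebra ℝ (Fin 8 → ℝ))
      (i₀ : ι), z i₀ = ζ → (∀ i, r i ∈ N) → SameOrbit quad8 K z →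
      SameOrbit quad11 G (fun i => spinAct quad11 (r i) (brane (z i)))) ∧
    -- every family of `(5,1)`-planes in one `G`-orbit which preserves the invariant spinor
    -- `(ψ, 0)` consists of null-rotated Cayley planes in one `K`-orbit
    (∀ (p : ι → ExteriorAlgebra ℝ Mink) (i₀ : ι), IsPlane51 (p i₀) → SameOrbit quad11 G p →
      spinorIncl ψ ∈ susy rho11 (p i₀) →
      ∃ (r : ι → spinGroup quad11) (z : ι → ExteriorAlgebra ℝ (Fin 8 → ℝ)),
        SameOrbit quad8 K z ∧
        ∀ i, r i ∈ nullRotations ∧ IsCalibrated (cayleyForm ψ) (z i) ∧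
          p i = spinAct quad11 (r i) (brane (z i))) := by
  obtain rfl : K.map spinEmb ⊔ N = G := hG.1
  have hinv {ζ} (hζ : IsPlane8 ζ) := invariants_inf_susy_brane (K := K) hN hN1 hζ
  refine ⟨⟨invariants_eq_deltaPrime hN hN1, finrank_deltaPrime, spinorIncl_injective,
    range_spinorIncl, spinorIncl_mulVec⟩, fun ζ hζ => ⟨isPlane51_brane hζ, hinv hζ⟩,
    fun ζ hζ φ hφ => hζ.mem_susy_iff_isCalibrated hφ, ?_, ?_, ?_⟩
  · intro ζ hζ p i₀ h₀ hp
    obtain ⟨r, z, rfl, hz, hpz⟩ := hp.exists_eq_spinAct_brane hG.2.2 hζ (one_mem N)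
      (h₀.trans (spinAct_one quad11 _).symm)
    obtain rfl : p = fun i => spinAct quad11 (r i) (brane (z i)) := funext fun i => (hpz i).2.2
    have hz8 i : IsPlane8 (z i) := (hpz i).2.1
    refine ⟨⟨r, z, rfl, hpz, hz, fun h => h.of_spinAct_brane hG hz8 (fun i => (hpz i).1) hz,
      fun φ hφ hφ0 => hz.isCalibrated hζ hφ.1 hφ0 hφ.2⟩,
      fun i => (isPlane51_brane (hz8 i)).spinAct (r i), h₀ ▸ hp.inf_susy_le rho11 i₀, fun h => ?_⟩
    refine hζ.exists_chiral_mem fun hbot => h ?_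
    rw [hinv hζ, hbot, Submodule.map_bot]
  · rintro _ hζ r z i₀ rfl hr hz
    exact hz.spinAct_brane (hz.isPlane8 hζ) hr
  · intro p i₀ hp₀ hp hs
    obtain ⟨r₀, hr₀, ζ, hζ, h₀, hψζ⟩ := exists_brane_of_mem_susy hψ hψc hp₀ hs
    obtain ⟨r, z, rfl, hz, hpz⟩ := (hp.mono (sup_le_sup_left hN _)).exists_eq_spinAct_brane
      (by rintro _ ⟨k, -, rfl⟩ x hx; exact conj_mem_nullRotations k hx) hζ hr₀ h₀
    exact ⟨r, z, hz, fun i => ⟨(hpz i).1,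
      hz.isCalibrated hζ hK hψ hψζ i, (hpz i).2.2⟩⟩
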